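/- **Theorem 4.1.** Let $m\ge 2$. The ExtendedHyperLogLog (EHLL) sketch consists of $m$ cells; cell $j$ stores a counter $C_1[j]\in\{0,1,2,\dots\}$, initially $0$, and a bit $C_2[j]\in\{0,1\}$, initially $1$. Every element $v$ of a stream is hashed to a pair $(j,\rho)$, where $j$ is uniform on $\{1,\dots,m\}$, $\rho$ is independent of $j$ with $\Pr(\rho=k)=2^{-k}$ for $k\ge1$, and the pairs of distinct elements are independent (equal elements have equal pairs). When an element with pair $(j,\rho)$ is processed, then * if $\rho=C_1[j]+1$, set $C_1[j]\leftarrow\rho$ and $C_2[j]\leftarrow1$; * else if $\rho>C_1[j]+1$, set $C_1[j]\leftarrow\rho$ and $C_2[j]\leftarrow0$; * else if $\rho=C_1[j]-1$ and $C_2[j]=0$, set $C_2[j]\leftarrow1$; * otherwise nothing changes. Let $$Y=\Bigl(\sum_{j=1}^m \bigl(2^{-C_1[j]}+(1-C_2[j])\,2^{-C_1[j]+1}\bigr)\Bigr)^{-1}.$$ Then, given the current sketch, $\frac1{mY}$ is the probability that the arrival of a new element (one that has not occurred in the stream) changes the sketch. After any stream, $Y$ is integrable, and for a nonempty stream its expectation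 depends on the stream only through the number $n$ of its distinct elements. Write $\mathbb E_n[Y]$ for this expectation. Further, with $$f(u)=\log_2\frac{2+u}{1+u}+\log_2\frac{4+3u}{3+3u}-\log_2\frac{4+u}{3+u},$$ the integral $\int_0^\infty f(u)^m\,du$ converges, and as $n\to\infty$ with $m$ fixed $$\mathbb E_n[Y]=\frac nm\left(\int_0^\infty f(u)^m\,du+\frac{\varepsilon}{m}+o(1)\right),$$ where $\varepsilon=\varepsilon_{m}(n)$ satisfies $|\varepsilon|\le 8.4\cdot10^{-5}$ for all $n$ and $m$. -/

import Mathlib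

open MeasureTheory

namespace EHLL

/-- The memory of ExtendedHyperLogLog: every cell `j` holds the counter `C₁[j]` and the bit
`C₂[j]` (`true` stands for `1`). -/
abbrev Sketch (m : ℕ) : Type := Fin m → ℕ × Bool

/-- The initial sketch: all counters are `0`, all bits are `1`. -/
def initial (m : ℕ) : Sketch m := fun _ => (0, true)

/-- The new content of a cell with content `c = (C₁, C₂)` that receives the value `r = ρ(y)`. -/
def cellUpdate (c : ℕ × Bool) (r : ℕ) : ℕ × Bool :=
  if r = c.1 + 1 then (r, true)
  else if c.1 + 1 < r then (r, false)
  else if r + 1 = c.1 ∧ c.2 = false then (c.1, true)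
  else c

/-- Processing of one element whose hash value is `x = (j, r)`: the cell `j` receives `r`. -/
def insert {m : ℕ} (s : Sketch m) (x : Fin m × ℕ) : Sketch m :=
  Function.update s x.1 (cellUpdate (s x.1) x.2)

/-- The sketch after the whole stream `M` has been processed with the hash function `h`. -/
def run {m : ℕ} {V : Type*} (h : V → Fin m × ℕ) (M : List V) : Sketch m :=
  M.foldl (fun s v => insert s (h v)) (initial m)

/-- The indicator `Y = (∑ⱼ 2^(-C₁[j]) + (1 - C₂[j]) 2^(-C₁[j] + 1))⁻¹`. -/
noncomputable def indicator {m : ℕ} (s : Sketch m) : ℝ :=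
  (∑ j : Fin m, ((2 : ℝ) ^ (-((s j).1 : ℤ)) +
    (1 - ((s j).2.toNat : ℝ)) * (2 : ℝ) ^ (-((s j).1 : ℤ) + 1)))⁻¹

/-- A random hash function: the hash values of distinct elements are independent, and each
hash value `(j, r)` consists of a uniform cell `j` and an independent `Geo(1/2)` variable `r`
with values in `{1, 2, …}`. -/
structure IsRandomHash {m : ℕ} {V Ω : Type*} [MeasurableSpace Ω] (P : Measure Ω)
    (h : V → Ω → Fin m × ℕ) : Prop where
  measurable : ∀ v, Measurable (h v)
  indep : ProbabilityTheory.iIndepFun h P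
  law : ∀ (v : V) (j : Fin m) (k : ℕ), 1 ≤ k →
    P.real {ω | h v ω = (j, k)} = (1 / (m : ℝ)) * (1 / 2 : ℝ) ^ k

/-- `f(u) = log₂((2+u)/(1+u)) + log₂((4+3u)/(3+3u)) - log₂((4+u)/(3+u))`. -/
noncomputable def f (u : ℝ) : ℝ :=
  Real.logb 2 ((2 + u) / (1 + u)) + Real.logb 2 ((4 + 3 * u) / (3 + 3 * u))
    - Real.logb 2 ((4 + u) / (3 + u))

end EHLL

/-! The reciprocal of `indicator` is a sum of positive cell values, so its mean is the integral over
t > 0 of the Laplace transform of that sum. If the number of distinct elements is Poisson with mean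
x per cell, the cells become independent, and inside a cell the values r arrive as independent
Poisson(x 2^{-r}) counts. The mean is then x times the integral over u > 0 of the m-th power of a
one-cell transform at t = xu (`tsum_poissonWeight_mul_meanIndicator`).

Up to an error O(1/(x(1+u))), that transform is a combination of sums over all integers k of e^{-a
2^k} - e^{-b 2^k}. Each such sum is log₂(b/a) plus an increment of a function `fluct` that is
invariant under doubling. The logarithms add up to f(u), the increments to `fluctF`
(`hasSum_levelTerm`, `cellTransform_eq`).

The increments of `fluct` are integrals of (`theta` s - 1/log 2)/s. By Poisson summation, the
Fourier coefficients of `theta` in the variable log₂ s have modulus |Γ(1 + 2πik/log 2)|/log 2, which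
is tiny for k ≠ 0; this gives the deviation 1.45e-5 in `abs_theta_sub_le`. Propagating it through
the m-th power and the integral gives the constant 8.4e-5 (`abs_fluctF_le`,
`poissonIntegral_bound`).

Returning to fixed n needs no complex analysis: processing an element never decreases `indicator`,
so the mean is monotone in n, and Chebyshev's inequality for Poisson parameters (1 ± d)n squeezes it
(`eventually_abs_div_sub_le`).

The law after n distinct elements comes from inclusion-exclusion over events "no hash value falls in
a given set", whose probabilities are n-th powers (`IsRandomHash.measureReal_run`). The same sets
give the probability that a new element changes the sketch (`IsRandomHash.cond_run_ne`). -/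

namespace EHLL

/-! ### Fourier coefficients of the Gumbel profile and bounds for Γ on the line Re = 1 -/

/-- The logarithmic profile of `y ↦ y e^{-y}`, in base `2`. -/
noncomputable def gumbel (x : ℝ) : ℂ :=
  ((Real.exp (-(Real.log 2 * x)) * Real.exp (-Real.exp (-(Real.log 2 * x))) : ℝ) : ℂ)

-- Γ is the Mellin transform of e^{-t}, and a Mellin transform is a Fourier transform after t =
-- e^{-v}; scaling v = x log 2 produces the factor 1/log 2.
open FourierTransform in
lemma fourier_gumbel (ξ : ℝ) :
    𝓕 gumbel ξ = (Real.log 2 : ℂ)⁻¹ * Complex.Gamma (1 + (2 * Real.pi * ξ / Real.log 2 : ℝ) * Complex.I) := by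
  have hl : (0:ℝ) < Real.log 2 := Real.log_pos (by norm_num)
  set s : ℂ := 1 + (2 * Real.pi * ξ / Real.log 2 : ℝ) * Complex.I with hs
  have hre : s.re = 1 := by
    rw [hs, Complex.add_re, Complex.re_ofReal_mul]; simp
  have him : s.im = 2 * Real.pi * ξ / Real.log 2 := by
    rw [hs, Complex.add_im, Complex.im_ofReal_mul]; simp
  have h1 : Complex.Gamma s = mellin (fun t : ℝ => ((Real.exp (-t) : ℝ) : ℂ)) s := by
    rw [Complex.Gamma_eq_integral (by rw [hre]; norm_num), Complex.GammaIntegral_eq_mellin]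
  rw [h1, mellin_eq_fourier, hre, him, Real.fourier_real_eq_integral_exp_smul,
    Real.fourier_real_eq_integral_exp_smul]
  have h2 := Measure.integral_comp_mul_left (fun v : ℝ =>
    Complex.exp (((-2 * Real.pi * v * (2 * Real.pi * ξ / Real.log 2 / (2 * Real.pi)) : ℝ) : ℂ) * Complex.I) •
      (Real.exp (-1 * v) • ((Real.exp (-Real.exp (-v)) : ℝ) : ℂ))) (Real.log 2)
  rw [abs_of_pos (inv_pos.2 hl)] at h2
  rw [show (Real.log 2 : ℂ)⁻¹ = ((Real.log 2)⁻¹ : ℝ) by push_cast; rfl, ← Complex.real_smul, ← h2]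
  congr 1 with v
  congr 1
  · congr 3
    field_simp
  · rw [gumbel]
    simp

/-- Conjugation turns the square into Γ(1+iy)Γ(1-iy) = iy Γ(iy)Γ(1-iy), to which the reflection
formula applies. -/
lemma norm_Gamma_one_add_mul_I_sq {y : ℝ} (hy : 0 < y) :
    ‖Complex.Gamma (1 + y * Complex.I)‖ ^ 2 = Real.pi * y / Real.sinh (Real.pi * y) := by
  have h1 : Complex.Gamma (1 + y * Complex.I) = y * Complex.I * Complex.Gamma (y * Complex.I) := by
    rw [add_comm, Complex.Gamma_add_one]
    simp [hy.ne']
  have h2 : (starRingEnd ℂ) (Complex.Gamma (1 + y * Complex.I)) = Complex.Gamma (1 - y * Complex.I) := by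
    rw [← Complex.Gamma_conj]; congr 1
    simp [sub_eq_add_neg]
  have h3 := Complex.mul_conj' (Complex.Gamma (1 + y * Complex.I))
  rw [h2, h1, mul_assoc, Complex.Gamma_mul_Gamma_one_sub] at h3
  have h4 : Complex.sin (Real.pi * (y * Complex.I)) = (Real.sinh (Real.pi * y) : ℝ) * Complex.I := by
    rw [← mul_assoc, Complex.sin_mul_I]; push_cast; rfl
  rw [h4] at h3
  have hsh : Real.sinh (Real.pi * y) ≠ 0 := by
    have : 0 < Real.sinh (Real.pi * y) := Real.sinh_pos_iff.2 (by positivity)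
    exact this.ne'
  have h5 : (y * Complex.I * (Real.pi / ((Real.sinh (Real.pi * y) : ℝ) * Complex.I)) : ℂ)
      = ((Real.pi * y / Real.sinh (Real.pi * y) : ℝ) : ℂ) := by
    have : ((Real.sinh (Real.pi * y) : ℝ) : ℂ) ≠ 0 := by exact_mod_cast hsh
    push_cast at this ⊢
    field_simp
  rw [h5, ← h1] at h3
  exact_mod_cast h3.symm

lemma norm_Gamma_one_add_mul_I_neg (y : ℝ) :
    ‖Complex.Gamma (1 + (-y : ℝ) * Complex.I)‖ = ‖Complex.Gamma (1 + y * Complex.I)‖ := by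
  rw [← Complex.norm_conj (Complex.Gamma (1 + y * Complex.I)), ← Complex.Gamma_conj]
  congr 2
  simp

/-- The first frequency of the fluctuations. -/
noncomputable def freq : ℝ := 2 * Real.pi / Real.log 2

lemma freq_pos : 0 < freq :=
  div_pos (mul_pos two_pos Real.pi_pos) (Real.log_pos (by norm_num))

lemma pi_mul_freq_bounds : 28.47 ≤ Real.pi * freq ∧ Real.pi * freq ≤ 28.48 := by
  have h1 := Real.pi_gt_d6
  have h2 := Real.pi_lt_d6
  have h3 := Real.log_two_gt_d9
  have h4 := Real.log_two_lt_d9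
  have hl : (0:ℝ) < Real.log 2 := by linarith
  have : Real.pi * freq = 2 * Real.pi ^ 2 / Real.log 2 := by rw [freq]; ring
  rw [this, le_div_iff₀ hl, div_le_iff₀ hl]
  constructor <;> nlinarith

lemma exp_lower : (2312500000000 : ℝ) ≤ Real.exp 28.47 := by
  have h : Real.exp 28.47 = Real.exp 1 ^ 28 * Real.exp 0.47 := by
    rw [← Real.exp_nat_mul, ← Real.exp_add]; norm_num
  have h2 : (1446250000000 : ℝ) ≤ Real.exp 1 ^ 28 := by
    calc (1446250000000 : ℝ) ≤ 2.7182818283 ^ 28 := by norm_num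
      _ ≤ _ := by gcongr; exact Real.exp_one_gt_d9.le
  rw [h]
  calc (2312500000000 : ℝ) ≤ 1446250000000 * 1.5993 := by norm_num
    _ ≤ _ := by
      gcongr
      have := Real.sum_le_exp_of_nonneg (show (0:ℝ) ≤ 0.47 by norm_num) 5
      refine le_trans ?_ this
      norm_num [Finset.sum_range_succ, Nat.factorial]

/-- With A = π·`freq` ≈ 28.47, the squared norm is A(n+1)/sinh(A(n+1)). The case n = 0 gives
28.48/1.156e12 < (4.97e-6)². Each further frequency gains at least e^A ≥ 2·10^6 in the denominator
against a factor 2 from n+1 ≤ 2^n, hence 10^{-3} after the square root. -/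
lemma norm_Gamma_freq (n : ℕ) :
    ‖Complex.Gamma (1 + ((n + 1 : ℕ) * freq : ℝ) * Complex.I)‖ ≤ 0.00000497 * (1 / 1000) ^ n := by
  obtain ⟨h1, h2⟩ := pi_mul_freq_bounds
  have hf := freq_pos
  set A := Real.pi * freq with hA
  have hApos : 0 < A := by linarith
  apply abs_le_of_sq_le_sq' _ (by positivity) |>.2
  rw [norm_Gamma_one_add_mul_I_sq (by positivity)]
  have hs1 : Real.sinh A * Real.exp (n * A) ≤ Real.sinh (A * (n+1 : ℕ)) := by
    rw [Real.sinh_eq, Real.sinh_eq]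
    have e1 : Real.exp A * Real.exp (n * A) = Real.exp (A * (n+1 : ℕ)) := by
      rw [← Real.exp_add]; push_cast; ring_nf
    have e2 : Real.exp (-(A * (n+1 : ℕ))) ≤ Real.exp (-A) * Real.exp (n * A) := by
      rw [← Real.exp_add, Real.exp_le_exp]; push_cast
      have : 0 ≤ n * A := by positivity
      nlinarith
    nlinarith
  have hs2 : (1156000000000 : ℝ) ≤ Real.sinh A := by
    rw [Real.sinh_eq]
    have := exp_lower.trans (Real.exp_le_exp.2 h1)
    have h3 : Real.exp (-A) ≤ 1 := Real.exp_le_one_iff.2 (by linarith)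
    linarith
  have hs3 : (2 * 10 ^ 6 : ℝ) ^ n ≤ Real.exp (n * A) := by
    rw [Real.exp_nat_mul]
    gcongr
    have := exp_lower.trans (Real.exp_le_exp.2 h1)
    linarith
  have hn : ((n + 1 : ℕ) : ℝ) ≤ 2 ^ n := by
    exact_mod_cast Nat.lt_two_pow_self
  have e : Real.pi * ((n + 1 : ℕ) * freq) = A * (n + 1 : ℕ) := by rw [hA]; ring
  rw [e, div_le_iff₀ (lt_of_lt_of_le (by positivity) hs1)]
  calc A * (n + 1 : ℕ) ≤ 28.48 * 2 ^ n := by gcongr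
    _ ≤ (0.00000497) ^ 2 * 1156000000000 * 2 ^ n := by gcongr; norm_num
    _ = (0.00000497 * (1 / 1000) ^ n) ^ 2 * (1156000000000 * (2 * 10 ^ 6) ^ n) := by
        rw [mul_pow, ← pow_mul, mul_comm n 2, pow_mul, mul_pow (2:ℝ)]
        rw [show ((1 / 1000 : ℝ)^2) ^ n = (1 / 10^6) ^ n by norm_num]
        have : ((1 / 10^6 : ℝ)) ^ n * (10^6) ^ n = 1 := by rw [← mul_pow]; norm_num
        linear_combination (-((0.00000497:ℝ) ^ 2 * 1156000000000 * 2 ^ n)) * this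
    _ ≤ (0.00000497 * (1 / 1000) ^ n) ^ 2 * (Real.sinh A * Real.exp (n * A)) := by gcongr
    _ ≤ _ := by gcongr

open FourierTransform in
lemma norm_fourier_gumbel_natCast_succ (n : ℕ) :
    ‖𝓕 gumbel ((n : ℤ) + 1 : ℤ)‖ ≤ (Real.log 2)⁻¹ * (0.00000497 * (1 / 1000) ^ n) := by
  have hl : (0:ℝ) < Real.log 2 := Real.log_pos (by norm_num)
  rw [fourier_gumbel, norm_mul, norm_inv, Complex.norm_real, Real.norm_of_nonneg hl.le]
  gcongr
  have h : 2 * Real.pi * ((n : ℤ) + 1 : ℤ) / Real.log 2 = (n + 1 : ℕ) * freq := by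
    rw [freq]; push_cast; ring
  rw [h]
  exact norm_Gamma_freq n

open FourierTransform in
lemma norm_fourier_gumbel_neg (ξ : ℝ) : ‖𝓕 gumbel (-ξ)‖ = ‖𝓕 gumbel ξ‖ := by
  rw [fourier_gumbel, fourier_gumbel, norm_mul, norm_mul]
  congr 1
  rw [← norm_Gamma_one_add_mul_I_neg]
  congr 5
  ring

open FourierTransform in
lemma fourier_gumbel_zero : 𝓕 gumbel 0 = ((Real.log 2)⁻¹ : ℝ) := by
  rw [fourier_gumbel]; simp

lemma continuous_gumbel : Continuous gumbel := by
  unfold gumbel; fun_prop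

/-- Quadratic decay is what the Poisson summation formula asks for. On the right e^{-y} beats y²; on
the left y² is at most 2e^{-y}, and the doubly exponential factor beats the square of e^{-y}. -/
lemma norm_gumbel_le {x : ℝ} (hx : x ≠ 0) : ‖gumbel x‖ ≤ 8 * (Real.log 2 ^ 2)⁻¹ * (x ^ 2)⁻¹ := by
  have hl : (0:ℝ) < Real.log 2 := Real.log_pos (by norm_num)
  rw [gumbel, Complex.norm_real, Real.norm_of_nonneg (by positivity), mul_assoc, ← mul_inv, ← mul_pow,
    ← div_eq_mul_inv]
  set y := Real.log 2 * x with hy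
  have hy0 : y ≠ 0 := by positivity
  rw [le_div_iff₀ (by positivity)]
  have key : ∀ z : ℝ, 0 ≤ z → z ^ 2 ≤ 2 * Real.exp z := fun z hz => by
    have := Real.quadratic_le_exp_of_nonneg hz
    nlinarith
  rcases le_total 0 y with h | h
  · have h1 := key y h
    have h2 : Real.exp (-Real.exp (-y)) ≤ 1 := Real.exp_le_one_iff.2 (by simpa using (Real.exp_pos _).le)
    calc Real.exp (-y) * Real.exp (-Real.exp (-y)) * y ^ 2
        ≤ Real.exp (-y) * 1 * (2 * Real.exp y) := by gcongr
      _ = 2 * (Real.exp (-y) * Real.exp y) := by ring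
      _ ≤ 8 := by rw [← Real.exp_add]; norm_num
  · set z := Real.exp (-y) with hz
    have hz0 : 0 < z := Real.exp_pos _
    have h1 : y ^ 2 ≤ 2 * z := by have := key (-y) (by linarith); rwa [neg_sq] at this
    have h2 := key z hz0.le
    calc z * Real.exp (-z) * y ^ 2
        ≤ z * Real.exp (-z) * (2 * z) := by gcongr
      _ = 2 * z ^ 2 * Real.exp (-z) := by ring
      _ ≤ 2 * (2 * Real.exp z) * Real.exp (-z) := by gcongr
      _ = 4 * (Real.exp z * Real.exp (-z)) := by ring
      _ ≤ 8 := by rw [← Real.exp_add]; norm_num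

open Asymptotics Filter in
lemma gumbel_isBigO : gumbel =O[cocompact ℝ] fun x : ℝ => |x| ^ (-2 : ℝ) := by
  refine IsBigO.of_bound (8 * (Real.log 2 ^ 2)⁻¹) ?_
  filter_upwards [(isCompact_singleton (x := (0:ℝ))).compl_mem_cocompact] with x hx
  refine (norm_gumbel_le hx).trans (le_of_eq ?_)
  rw [Real.norm_of_nonneg (by positivity), Real.rpow_neg (abs_nonneg _)]
  simp

lemma hasSum_norm_fourier_gumbel_bound :
    HasSum (fun n : ℕ => (Real.log 2)⁻¹ * (0.00000497 * (1 / 1000 : ℝ) ^ n))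
      ((Real.log 2)⁻¹ * (0.00000497 * (1 - 1 / 1000)⁻¹)) :=
  ((hasSum_geometric_of_lt_one (by norm_num) (by norm_num)).mul_left _).mul_left _

lemma summable_int_of_norm_le {c : ℤ → ℂ} {b : ℕ → ℝ} (hb : Summable b)
    (h1 : ∀ n : ℕ, ‖c ((n : ℤ) + 1)‖ ≤ b n) (h2 : ∀ n : ℕ, ‖c (-((n : ℤ) + 1))‖ ≤ b n) :
    Summable c := by
  have h1' : Summable fun n : ℕ => c ((n + 1 : ℕ) : ℤ) :=
    Summable.of_norm_bounded hb fun n => by exact_mod_cast h1 n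
  exact Summable.of_nat_of_neg_add_one ((summable_nat_add_iff (f := fun n : ℕ => c n) 1).1 h1')
    (Summable.of_norm_bounded hb h2)

lemma norm_tsum_int_sub_le {c : ℤ → ℂ} {b : ℕ → ℝ} {K : ℝ} (hb : HasSum b K)
    (h1 : ∀ n : ℕ, ‖c ((n : ℤ) + 1)‖ ≤ b n) (h2 : ∀ n : ℕ, ‖c (-((n : ℤ) + 1))‖ ≤ b n) :
    ‖∑' n, c n - c 0‖ ≤ 2 * K := by
  have h1' : ∀ n : ℕ, ‖c ((n + 1 : ℕ) : ℤ)‖ ≤ b n := fun n => by exact_mod_cast h1 n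
  have s1 : Summable fun n : ℕ => c ((n + 1 : ℕ) : ℤ) := Summable.of_norm_bounded hb.summable h1'
  have s0 : Summable fun n : ℕ => c n := (summable_nat_add_iff (f := fun n : ℕ => c n) 1).1 s1
  have s2 : Summable fun n : ℕ => c (-((n : ℤ) + 1)) := Summable.of_norm_bounded hb.summable h2
  rw [tsum_of_nat_of_neg_add_one s0 s2, s0.tsum_eq_zero_add, Nat.cast_zero, add_assoc,
    add_sub_cancel_left, two_mul]
  exact (norm_add_le _ _).trans
    (add_le_add (tsum_of_norm_bounded hb h1') (tsum_of_norm_bounded hb h2))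

open FourierTransform in
lemma norm_fourier_gumbel_neg_natCast_succ (n : ℕ) :
    ‖𝓕 gumbel (-((n : ℤ) + 1) : ℤ)‖ ≤ (Real.log 2)⁻¹ * (0.00000497 * (1 / 1000) ^ n) := by
  rw [Int.cast_neg, norm_fourier_gumbel_neg]
  exact norm_fourier_gumbel_natCast_succ n

/-! ### Poisson summation for the periodic function -/

/-- The periodic function whose logarithmic mean value is `1 / log 2`. -/
noncomputable def theta (s : ℝ) : ℝ := ∑' k : ℤ, s * 2 ^ k * Real.exp (-(s * 2 ^ k))

lemma tsum_gumbel {s : ℝ} (hs : 0 < s) :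
    ∑' n : ℤ, gumbel (-(Real.logb 2 s) + n) = (theta s : ℂ) := by
  rw [theta, Complex.ofReal_tsum, ← (Equiv.neg ℤ).tsum_eq]
  congr 1 with n
  have : Real.exp (-(Real.log 2 * (-Real.logb 2 s + ((-n : ℤ) : ℝ)))) = s * 2 ^ n := by
    rw [show -(Real.log 2 * (-Real.logb 2 s + ((-n : ℤ) : ℝ)))
      = Real.log 2 * Real.logb 2 s + Real.log 2 * (n : ℝ) by push_cast; ring, Real.exp_add,
      Real.exp_mul, Real.exp_mul, Real.exp_log two_pos, Real.rpow_logb two_pos (by norm_num) hs,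
      Real.rpow_intCast]
  rw [gumbel, Equiv.neg_apply, this]

-- The zeroth Fourier coefficient is the mean value 1/log 2, and the others contribute at most
-- 2·4.97e-6·(1000/999)/log 2 < 1.45e-5.
open FourierTransform in
lemma abs_theta_sub_le {s : ℝ} (hs : 0 < s) : |theta s - (Real.log 2)⁻¹| ≤ 0.0000145 := by
  have hb := hasSum_norm_fourier_gumbel_bound
  have hP := Real.tsum_eq_tsum_fourier_of_rpow_decay_of_summable continuous_gumbel one_lt_two
    gumbel_isBigO (summable_int_of_norm_le hb.summable norm_fourier_gumbel_natCast_succ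
      norm_fourier_gumbel_neg_natCast_succ) (-(Real.logb 2 s))
  rw [tsum_gumbel hs] at hP
  have hn : ∀ n : ℤ, ‖𝓕 gumbel n * fourier n (((-(Real.logb 2 s) : ℝ)) : UnitAddCircle)‖
      = ‖𝓕 gumbel n‖ := fun n => by
    rw [norm_mul, fourier_apply, Circle.norm_coe, mul_one]
  have h := norm_tsum_int_sub_le
    (c := fun n : ℤ => 𝓕 gumbel n * fourier n (((-(Real.logb 2 s) : ℝ)) : UnitAddCircle)) hb
    (fun n => (hn _).trans_le (norm_fourier_gumbel_natCast_succ n))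
    (fun n => (hn _).trans_le (norm_fourier_gumbel_neg_natCast_succ n))
  rw [← hP, Int.cast_zero, fourier_gumbel_zero, fourier_zero, mul_one, ← Complex.ofReal_sub,
    Complex.norm_real, Real.norm_eq_abs] at h
  refine h.trans ?_
  have h3 := Real.log_two_gt_d9
  have : (Real.log 2)⁻¹ ≤ (0.6931471803 : ℝ)⁻¹ := by gcongr
  calc _ ≤ 2 * ((0.6931471803 : ℝ)⁻¹ * (0.00000497 * (1 - 1 / 1000 : ℝ)⁻¹)) := by gcongr
    _ ≤ _ := by norm_num

lemma summable_two_zpow_mul_exp {a : ℝ} (ha : 0 < a) :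
    Summable fun k : ℤ => (2:ℝ) ^ k * Real.exp (-(a * 2 ^ k)) := by
  have hg : Summable fun n : ℕ => (1 / 2 : ℝ) ^ n := summable_geometric_two
  refine Summable.of_nat_of_neg ?_ ?_
  · refine Summable.of_nonneg_of_le (fun n => by positivity) (fun n => ?_) (hg.mul_left (2 / a ^ 2))
    have hz : (0:ℝ) < 2 ^ n := by positivity
    have := Real.quadratic_le_exp_of_nonneg (x := a * 2 ^ n) (by positivity)
    rw [zpow_natCast, Real.exp_neg, one_div, inv_pow, div_mul_eq_mul_div, ← div_eq_mul_inv,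
      ← div_eq_mul_inv, div_div, div_le_div_iff₀ (Real.exp_pos _) (by positivity)]
    have h2 : 0 ≤ a * 2 ^ n := by positivity
    nlinarith
  · refine Summable.of_nonneg_of_le (fun n => by positivity) (fun n => ?_) hg
    rw [zpow_neg, zpow_natCast, one_div, inv_pow]
    refine mul_le_of_le_one_right (by positivity) (Real.exp_le_one_iff.2 ?_)
    have : 0 ≤ a * (2 ^ n)⁻¹ := by positivity
    linarith

lemma integral_mul_exp (a b z : ℝ) :
    ∫ s in a..b, z * Real.exp (-(s * z)) = Real.exp (-(a * z)) - Real.exp (-(b * z)) := by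
  have h : ∀ s ∈ Set.uIcc a b, HasDerivAt (fun s => -Real.exp (-(s * z))) (z * Real.exp (-(s * z))) s := by
    intro s _
    have := (((hasDerivAt_id s).mul_const z).neg.exp).neg
    refine this.congr_deriv ?_
    change -(Real.exp (-(s * z)) * -(1 * z)) = _
    ring
  rw [intervalIntegral.integral_eq_sub_of_hasDerivAt h
    (Continuous.intervalIntegrable (by fun_prop) _ _)]
  ring

lemma theta_div {s : ℝ} (hs : 0 < s) :
    theta s / s = ∑' k : ℤ, (2:ℝ) ^ k * Real.exp (-(s * 2 ^ k)) := by
  rw [theta, ← tsum_div_const]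
  congr 1 with k
  field_simp

/-- Each term is the integral of 2^k e^{-s 2^k} over [a, b]. The integrands are summable uniformly
on [a, b] because a > 0, so sum and integral may be exchanged. -/
lemma hasSum_exp_sub_exp {a b : ℝ} (ha : 0 < a) (hab : a ≤ b) :
    HasSum (fun k : ℤ => Real.exp (-(a * 2 ^ k)) - Real.exp (-(b * 2 ^ k)))
      (∫ s in a..b, theta s / s) := by
  have h := intervalIntegral.hasSum_intervalIntegral_of_summable_norm (a := a) (b := b)
    (f := fun k : ℤ => (⟨fun s : ℝ => (2:ℝ) ^ k * Real.exp (-(s * 2 ^ k)), by fun_prop⟩ : C(ℝ, ℝ)))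
    (Summable.of_nonneg_of_le (fun _ => norm_nonneg _) (fun k => by
      rw [ContinuousMap.norm_le _ (by positivity)]
      rintro ⟨s, hs⟩
      have hs' : s ∈ Set.uIcc a b := hs
      rw [Set.uIcc_of_le hab] at hs'
      simp only [ContinuousMap.restrict_apply, ContinuousMap.coe_mk]
      rw [Real.norm_of_nonneg (by positivity)]
      gcongr
      exact hs'.1) (summable_two_zpow_mul_exp ha))
  simp only [ContinuousMap.coe_mk, integral_mul_exp] at h
  have e : ∫ s in a..b, theta s / s
      = ∫ s in a..b, ∑' k : ℤ, (2:ℝ) ^ k * Real.exp (-(s * 2 ^ k)) := by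
    refine intervalIntegral.integral_congr fun s hs => ?_
    rw [Set.uIcc_of_le hab] at hs
    exact theta_div (ha.trans_le hs.1)
  rw [e]
  exact h

/-! ### Dyadic sums of exponential differences: logarithm plus fluctuation -/

/-- The sum of `e^{-a 2^k} - e^{-b 2^k}` over all integers `k`. -/
noncomputable def expDiff (a b : ℝ) : ℝ :=
  ∑' k : ℤ, (Real.exp (-(a * 2 ^ k)) - Real.exp (-(b * 2 ^ k)))

lemma summable_exp_sub_exp {a b : ℝ} (ha : 0 < a) (hb : 0 < b) :
    Summable fun k : ℤ => Real.exp (-(a * 2 ^ k)) - Real.exp (-(b * 2 ^ k)) := by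
  rcases le_total a b with h | h
  · exact (hasSum_exp_sub_exp ha h).summable
  · simpa using (hasSum_exp_sub_exp hb h).summable.neg

lemma expDiff_add {a b c : ℝ} (ha : 0 < a) (hb : 0 < b) (hc : 0 < c) :
    expDiff a b + expDiff b c = expDiff a c := by
  rw [expDiff, expDiff, ← (summable_exp_sub_exp ha hb).tsum_add (summable_exp_sub_exp hb hc), expDiff]
  congr 1 with k
  ring

lemma expDiff_two_mul (a b : ℝ) : expDiff (2 * a) (2 * b) = expDiff a b := by
  rw [expDiff, expDiff, ← (Equiv.addRight (1:ℤ)).tsum_eq (fun k : ℤ => _ - Real.exp (-(b * 2 ^ k)))]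
  congr 1 with k
  simp only [Equiv.coe_addRight]
  rw [zpow_add_one₀ two_ne_zero]
  ring_nf

open Filter Topology in
lemma tsum_int_sub_succ {F : ℤ → ℝ} {A B : ℝ} (hs : Summable fun k => F k - F (k + 1))
    (hA : Tendsto (fun n : ℕ => F (-(n : ℤ))) atTop (𝓝 A))
    (hB : Tendsto (fun n : ℕ => F n) atTop (𝓝 B)) : ∑' k, (F k - F (k + 1)) = A - B := by
  have i1 : Function.Injective fun n : ℕ => (n : ℤ) := fun a b h => Int.ofNat.inj h
  have i2 : Function.Injective fun n : ℕ => -((n : ℤ) + 1) := fun a b h => by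
    have h' : -((a : ℤ) + 1) = -((b : ℤ) + 1) := h
    omega
  have s1 : Summable fun n : ℕ => F n - F ((n : ℤ) + 1) := hs.comp_injective i1
  have s2 : Summable fun n : ℕ => F (-((n : ℤ) + 1)) - F (-((n : ℤ) + 1) + 1) :=
    hs.comp_injective i2
  have h1 : HasSum (fun n : ℕ => F n - F ((n : ℤ) + 1)) (F 0 - B) := by
    refine s1.hasSum_iff_tendsto_nat.2 ((hB.const_sub (F 0)).congr fun n => ?_)
    induction n with
    | zero => simp
    | succ n ih => rw [Finset.sum_range_succ, ← ih]; push_cast; ring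
  have h2 : HasSum (fun n : ℕ => F (-((n : ℤ) + 1)) - F (-((n : ℤ) + 1) + 1)) (A - F 0) := by
    refine s2.hasSum_iff_tendsto_nat.2 ((hA.sub_const (F 0)).congr fun n => ?_)
    induction n with
    | zero => simp
    | succ n ih =>
      rw [Finset.sum_range_succ, ← ih]
      have : -((n : ℤ) + 1) + 1 = -(n : ℤ) := by ring
      rw [this]; push_cast; ring
  have h := HasSum.of_nat_of_neg_add_one (f := fun k => F k - F (k + 1)) h1 h2
  rw [h.tsum_eq]
  ring

/-- The series telescopes, since e^{-2^k} runs from 1 at k = -∞ to 0 at k = +∞. This normalization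
makes log₂ the right function to subtract in `fluct`. -/
lemma expDiff_one_two : expDiff 1 2 = 1 := by
  have hs := summable_exp_sub_exp one_pos two_pos
  have e : ∀ k : ℤ, Real.exp (-(1 * 2 ^ k)) - Real.exp (-(2 * 2 ^ k))
      = Real.exp (-2 ^ k) - Real.exp (-2 ^ (k + 1)) := fun k => by
    rw [zpow_add_one₀ two_ne_zero, one_mul, mul_comm (2:ℝ)]
  rw [expDiff]
  simp only [e] at hs ⊢
  rw [tsum_int_sub_succ (A := 1) (B := 0) (F := fun k : ℤ => Real.exp (-2 ^ k)) hs, sub_zero]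
  · have : Filter.Tendsto (fun n : ℕ => Real.exp (-(1 / 2 : ℝ) ^ n)) Filter.atTop (nhds (Real.exp (-0))) :=
      (Real.continuous_exp.tendsto _).comp
        (tendsto_pow_atTop_nhds_zero_of_lt_one (by norm_num) (by norm_num)).neg
    simpa using this
  · have : Filter.Tendsto (fun n : ℕ => Real.exp (-(2:ℝ) ^ n)) Filter.atTop (nhds 0) :=
      Real.tendsto_exp_neg_atTop_nhds_zero.comp (tendsto_pow_atTop_atTop_of_one_lt one_lt_two)
    simpa using this

/-- The periodic fluctuation of `b ↦ expDiff 1 b` around `log₂ b`. -/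
noncomputable def fluct (b : ℝ) : ℝ := expDiff 1 b - Real.logb 2 b

lemma fluct_two_mul {b : ℝ} (hb : 0 < b) : fluct (2 * b) = fluct b := by
  have h1 := expDiff_add one_pos two_pos (mul_pos two_pos hb)
  have h2 := expDiff_two_mul 1 b
  rw [mul_one] at h2
  rw [fluct, fluct, ← h1, h2, expDiff_one_two, Real.logb_mul two_ne_zero hb.ne',
    Real.logb_self_eq_one one_lt_two]
  ring

lemma expDiff_eq {a b : ℝ} (ha : 0 < a) (hb : 0 < b) :
    expDiff a b = Real.logb 2 (b / a) + (fluct b - fluct a) := by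
  rw [fluct, fluct, ← expDiff_add one_pos ha hb, Real.logb_div hb.ne' ha.ne']
  ring

/-- Both `expDiff` and log₂ are integrals against ds/s, of `theta` and of the constant 1/log 2, so
the uniform bound on their difference integrates to a multiple of log(b/a). -/
lemma abs_fluct_sub_le {a b : ℝ} (ha : 0 < a) (hab : a ≤ b) :
    |fluct b - fluct a| ≤ 0.0000145 * Real.log (b / a) := by
  have hb := ha.trans_le hab
  have h1 := expDiff_eq ha hb
  have h2 : expDiff a b = ∫ s in a..b, theta s / s := (hasSum_exp_sub_exp ha hab).tsum_eq
  have h3 : ∫ s in a..b, s⁻¹ = Real.log (b / a) := integral_inv_of_pos ha hb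
  have hl : (0:ℝ) < Real.log 2 := Real.log_pos (by norm_num)
  have hi : IntervalIntegrable (fun s : ℝ => s⁻¹) volume a b :=
    intervalIntegral.intervalIntegrable_inv (fun s hs => by
      rw [Set.uIcc_of_le hab] at hs; exact (ha.trans_le hs.1).ne') continuousOn_id
  have hθ : IntervalIntegrable (fun s : ℝ => theta s / s) volume a b := by
    refine ContinuousOn.intervalIntegrable ?_
    rw [Set.uIcc_of_le hab]
    refine ContinuousOn.congr (f := fun s => ∑' k : ℤ, (2:ℝ) ^ k * Real.exp (-(s * 2 ^ k))) ?_
      fun s hs => theta_div (ha.trans_le hs.1)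
    refine continuousOn_tsum (fun k => by fun_prop) (summable_two_zpow_mul_exp ha) fun k s hs => ?_
    rw [Real.norm_of_nonneg (by positivity)]
    gcongr
    exact hs.1
  have h4 : fluct b - fluct a = ∫ s in a..b, (theta s - (Real.log 2)⁻¹) * s⁻¹ := by
    simp only [sub_mul]
    rw [intervalIntegral.integral_sub (by simpa only [div_eq_mul_inv] using hθ) (hi.const_mul _),
      intervalIntegral.integral_const_mul, h3]
    simp only [← div_eq_mul_inv]
    rw [← h2, h1, Real.logb]
    field_simp; ring
  rw [h4, ← h3, ← intervalIntegral.integral_const_mul, ← Real.norm_eq_abs]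
  refine intervalIntegral.norm_integral_le_of_norm_le hab ?_ (hi.const_mul _)
  refine Filter.Eventually.of_forall fun s hs => ?_
  have hs0 : 0 < s := ha.trans hs.1
  rw [norm_mul, Real.norm_eq_abs, Real.norm_of_nonneg (inv_nonneg.2 hs0.le)]
  gcongr
  exact abs_theta_sub_le hs0

/-! ### Elementary bounds for f -/

/-- This is t ≤ sinh t at t = log y. -/
lemma log_le_half_sub_inv {y : ℝ} (hy : 1 ≤ y) : Real.log y ≤ (y - y⁻¹) / 2 := by
  have h := Real.self_le_sinh_iff.2 (Real.log_nonneg hy)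
  rwa [Real.sinh_eq, Real.exp_neg, Real.exp_log (by linarith)] at h

lemma log_succ_div_le {c : ℝ} (hc : 0 < c) : Real.log ((c + 1) / c) ≤ (1 / c + 1 / (c + 1)) / 2 := by
  refine (log_le_half_sub_inv ?_).trans (le_of_eq ?_)
  · rw [le_div_iff₀ hc]; linarith
  · field_simp; ring

lemma le_log_succ_div {c : ℝ} (hc : 0 < c) : 2 / (2 * c + 1) ≤ Real.log ((c + 1) / c) := by
  have h := Real.le_log_one_add_of_nonneg (x := 1 / c) (by positivity)
  have e1 : 1 + 1 / c = (c + 1) / c := by field_simp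
  have e2 : 2 * (1 / c) / (1 / c + 2) = 2 / (2 * c + 1) := by field_simp; ring
  rwa [e1, e2] at h

lemma log_div_le {a b : ℝ} (ha : 0 < a) (hb : 0 < b) : Real.log (b / a) ≤ (b - a) / a := by
  refine (Real.log_le_sub_one_of_pos (by positivity)).trans (le_of_eq ?_)
  field_simp

/-- `f` without the normalization of the logarithm. -/
noncomputable def logF (u : ℝ) : ℝ :=
  Real.log ((2 + u) / (1 + u)) + Real.log ((4 + 3 * u) / (3 + 3 * u))
    - Real.log ((4 + u) / (3 + u))

lemma f_eq (u : ℝ) : f u = logF u / Real.log 2 := by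
  rw [f, logF, Real.logb, Real.logb, Real.logb]; ring

lemma logF_eq {u : ℝ} (hu : 0 ≤ u) : logF u = Real.log (2 + u) - Real.log (1 + u) +
    (Real.log (4 + 3 * u) - Real.log (3 + 3 * u)) - (Real.log (4 + u) - Real.log (3 + u)) := by
  rw [logF, Real.log_div (by positivity) (by positivity), Real.log_div (by positivity) (by positivity),
    Real.log_div (by positivity) (by positivity)]

lemma logF_zero : logF 0 = Real.log 2 := by
  rw [logF]; norm_num

lemma hasDerivAt_log_add_mul {a b u : ℝ} (h : a + b * u ≠ 0) :
    HasDerivAt (fun u => Real.log (a + b * u)) (b / (a + b * u)) u := by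
  have := (((hasDerivAt_id u).const_mul b).const_add a).log h
  simpa using this

/-- Both sides equal log 2 at u = 0, where their slopes are -2/3 on the left and -0.95·log 2 ≈
-0.6585 on the right; the constant 0.95 lies just below the limit 2/(3 log 2) ≈ 0.962. The
difference of the two sides is increasing on [0, 1]. -/
lemma logF_le_of_le_one {u : ℝ} (hu : 0 ≤ u) (hu1 : u ≤ 1) :
    logF u ≤ Real.log 2 / (1 + 0.95 * u) := by
  have h2 := Real.log_two_lt_d9
  let G : ℝ → ℝ := fun u => Real.log 2 * (1 + 0.95 * u)⁻¹ -
    (Real.log (2 + 1 * u) - Real.log (1 + 1 * u) +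
    (Real.log (4 + 3 * u) - Real.log (3 + 3 * u)) - (Real.log (4 + 1 * u) - Real.log (3 + 1 * u)))
  let G' : ℝ → ℝ := fun u => Real.log 2 * (-(0.95) / (1 + 0.95 * u) ^ 2) -
    (1 / (2 + 1 * u) - 1 / (1 + 1 * u) +
    (3 / (4 + 3 * u) - 3 / (3 + 3 * u)) - (1 / (4 + 1 * u) - 1 / (3 + 1 * u)))
  have hd : ∀ u : ℝ, 0 ≤ u → HasDerivAt G (G' u) u := fun u hu => by
    have hi : HasDerivAt (fun u : ℝ => (1 + 0.95 * u)⁻¹) (-(0.95) / (1 + 0.95 * u) ^ 2) u := by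
      have := (((hasDerivAt_id u).const_mul (0.95:ℝ)).const_add 1).fun_inv (by simp only [id]; positivity)
      simpa using this
    exact (hi.const_mul _).sub
      ((((hasDerivAt_log_add_mul (by positivity)).sub (hasDerivAt_log_add_mul (by positivity))).add
      ((hasDerivAt_log_add_mul (by positivity)).sub (hasDerivAt_log_add_mul (by positivity)))).sub
      ((hasDerivAt_log_add_mul (by positivity)).sub (hasDerivAt_log_add_mul (by positivity))))
  have hmono : MonotoneOn G (Set.Icc 0 1) := by
    refine monotoneOn_of_hasDerivWithinAt_nonneg (f' := G') (convex_Icc 0 1)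
      (fun u hu => (hd u hu.1).continuousAt.continuousWithinAt)
      (fun u hu => (hd u (interior_subset hu).1).hasDerivWithinAt) fun u hu => ?_
    obtain ⟨h0, h1⟩ : u ∈ Set.Icc (0:ℝ) 1 := interior_subset hu
    have e : G' u = (((4 + 3 * u) * (3 + u) * (4 + u) + (2 + u) * (3 + u) * (4 + u)
        - (1 + u) * (2 + u) * (4 + 3 * u)) * (1 + 0.95 * u) ^ 2
        - 0.95 * Real.log 2 * ((1 + u) * (2 + u) * (4 + 3 * u) * (3 + u) * (4 + u)))
        / ((1 + u) * (2 + u) * (4 + 3 * u) * (3 + u) * (4 + u) * (1 + 0.95 * u) ^ 2) := by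
      simp only [G', one_mul]
      have : 3 + 3 * u = 3 * (1 + u) := by ring
      rw [this]
      field_simp
      ring
    rw [e]
    refine div_nonneg ?_ (by positivity)
    have h3 : 0.95 * Real.log 2 * ((1 + u) * (2 + u) * (4 + 3 * u) * (3 + u) * (4 + u))
        ≤ 0.6585 * ((1 + u) * (2 + u) * (4 + 3 * u) * (3 + u) * (4 + u)) := by
      gcongr; linarith
    have h4 : u ^ 4 ≤ u := by
      simpa using pow_le_pow_of_le_one h0 h1 (show 1 ≤ 4 by norm_num)
    have h5 : u ^ 5 ≤ u := by
      simpa using pow_le_pow_of_le_one h0 h1 (show 1 ≤ 5 by norm_num)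
    have h6 : 0 ≤ u ^ 2 := by positivity
    have h7 : 0 ≤ u ^ 3 := by positivity
    nlinarith
  have h := hmono (Set.left_mem_Icc.2 zero_le_one) ⟨hu, hu1⟩ hu
  have e0 : G 0 = 0 := by
    have := logF_zero
    rw [logF_eq le_rfl] at this
    simp only [G, one_mul, mul_zero, add_zero, inv_one, mul_one] at this ⊢
    rw [this]; ring
  rw [e0] at h
  simp only [G, one_mul, ← logF_eq hu] at h
  rw [div_eq_mul_inv]
  linarith

/-- Rational bounds for the logarithms suffice away from 0: in v = u - 1 the difference of the two
sides has a numerator with positive coefficients. -/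
lemma logF_le_of_one_le {u : ℝ} (hu : 1 ≤ u) : logF u ≤ Real.log 2 / (1 + 0.95 * u) := by
  have h0 : 0 ≤ u := by linarith
  have h2 := Real.log_two_gt_d9
  have a1 := log_succ_div_le (c := 1 + u) (by linarith)
  have a2 := log_succ_div_le (c := 3 + 3 * u) (by linarith)
  have a3 := le_log_succ_div (c := 3 + u) (by linarith)
  rw [show 1 + u + 1 = 2 + u by ring] at a1
  rw [show 3 + 3 * u + 1 = 4 + 3 * u by ring] at a2
  rw [show 3 + u + 1 = 4 + u by ring] at a3
  have key : (1 / (1 + u) + 1 / (2 + u)) / 2 + (1 / (3 + 3 * u) + 1 / (4 + 3 * u)) / 2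
      - 2 / (2 * (3 + u) + 1) ≤ 0.6931 / (1 + 0.95 * u) := by
    rw [← sub_nonneg]
    obtain ⟨v, rfl⟩ : ∃ v, u = 1 + v := ⟨u - 1, by ring⟩
    have hv : 0 ≤ v := by linarith
    have e : 0.6931 / (1 + 0.95 * (1 + v)) - ((1 / (1 + (1 + v)) + 1 / (2 + (1 + v))) / 2 +
        (1 / (3 + 3 * (1 + v)) + 1 / (4 + 3 * (1 + v))) / 2 - 2 / (2 * (3 + (1 + v)) + 1))
        = (27.5508 + 188.2746 * v + 219.3144 * v ^ 2 + 93.2606 * v ^ 3 + 13.5516 * v ^ 4) /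
          (6 * (2 + v) * (3 + v) * (7 + 3 * v) * (9 + 2 * v) * (1.95 + 0.95 * v)) := by
      have : 3 + 3 * (1 + v) = 3 * (2 + v) := by ring
      rw [this, show 1 + (1 + v) = 2 + v by ring, show 2 + (1 + v) = 3 + v by ring,
        show 4 + 3 * (1 + v) = 7 + 3 * v by ring, show 2 * (3 + (1 + v)) + 1 = 9 + 2 * v by ring,
        show 1 + 0.95 * (1 + v) = 1.95 + 0.95 * v by ring]
      field_simp
      ring
    rw [e]
    positivity
  have h3 : 0.6931 / (1 + 0.95 * u) ≤ Real.log 2 / (1 + 0.95 * u) := by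
    gcongr; linarith
  rw [logF]
  linarith

lemma logF_le {u : ℝ} (hu : 0 ≤ u) : logF u ≤ Real.log 2 / (1 + 0.95 * u) := by
  rcases le_total u 1 with h | h
  · exact logF_le_of_le_one hu h
  · exact logF_le_of_one_le h

lemma logF_nonneg {u : ℝ} (hu : 0 ≤ u) : 0 ≤ logF u := by
  have h : Real.log ((4 + u) / (3 + u)) ≤ Real.log ((2 + u) / (1 + u)) := by
    refine Real.log_le_log (by positivity) ?_
    rw [div_le_div_iff₀ (by positivity) (by positivity)]
    nlinarith
  have h2 : 0 ≤ Real.log ((4 + 3 * u) / (3 + 3 * u)) := Real.log_nonneg (by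
    rw [le_div_iff₀ (by positivity)]; linarith)
  rw [logF]; linarith

lemma f_nonneg {u : ℝ} (hu : 0 ≤ u) : 0 ≤ f u := by
  rw [f_eq]; exact div_nonneg (logF_nonneg hu) (Real.log_nonneg one_le_two)

lemma f_le {u : ℝ} (hu : 0 ≤ u) : f u ≤ 1 / (1 + 0.95 * u) := by
  have hl : (0:ℝ) < Real.log 2 := Real.log_pos one_lt_two
  rw [f_eq, div_le_iff₀ hl]
  refine (logF_le hu).trans (le_of_eq ?_)
  ring

/-! ### Bounds for the fluctuation of the one-cell transform -/

/-- The fluctuation around `f u` for the load `x` per cell. -/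
noncomputable def fluctF (x u : ℝ) : ℝ :=
  (fluct (x * (2 + u)) - fluct (x * (1 + u))) - (fluct (x * (4 + u)) - fluct (x * (3 + u)))
    + (fluct (x * (4 + 3 * u)) - fluct (x * (3 + 3 * u)))

lemma abs_fluct_mul_sub_le {x a b : ℝ} (hx : 0 < x) (ha : 0 < a) (hab : a ≤ b) :
    |fluct (x * b) - fluct (x * a)| ≤ 0.0000145 * Real.log (b / a) := by
  have := abs_fluct_sub_le (mul_pos hx ha) (mul_le_mul_of_nonneg_left hab hx.le)
  rwa [mul_div_mul_left _ _ hx.ne'] at this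

lemma fluct_mul_half {x a b : ℝ} (hx : 0 < x) (ha : 0 < a) (h : b = 2 * a) :
    fluct (x * b) = fluct (x * a) := by
  rw [h, ← fluct_two_mul (mul_pos hx ha)]; ring_nf

/-- Invariance under doubling brings 2+u, 4+u and 4+3u back near 1. The six points then pair up so
that the points of each pair coincide at u = 0, and the logarithmic gaps are at most u/4, u/4 and
2u/3. -/
lemma abs_fluctF_le_small {x u : ℝ} (hx : 0 < x) (hu : 0 ≤ u) :
    |fluctF x u| ≤ 0.0000145 * (7 / 6 * u) := by
  have e1 := fluct_mul_half (x := x) (a := 1 + u / 2) (b := 2 + u) hx (by positivity) (by ring)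
  have e2 := fluct_mul_half (x := x) (a := 2 + u / 2) (b := 4 + u) hx (by positivity) (by ring)
  have e3 := fluct_mul_half (x := x) (a := 1 + u / 4) (b := 2 + u / 2) hx (by positivity) (by ring)
  have e4 := fluct_mul_half (x := x) (a := 2 + 3 * u / 2) (b := 4 + 3 * u) hx (by positivity) (by ring)
  have e5 := fluct_mul_half (x := x) (a := 1 + 3 * u / 4) (b := 2 + 3 * u / 2) hx (by positivity) (by ring)
  have b1 := abs_fluct_mul_sub_le (x := x) (a := 1 + u / 4) (b := 1 + u / 2) hx (by positivity) (by linarith)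
  have b2 := abs_fluct_mul_sub_le (x := x) (a := 1 + 3 * u / 4) (b := 1 + u) hx (by positivity) (by linarith)
  have b3 := abs_fluct_mul_sub_le (x := x) (a := 3 + u) (b := 3 + 3 * u) hx (by positivity) (by linarith)
  have l1 := log_div_le (a := 1 + u / 4) (b := 1 + u / 2) (by positivity) (by positivity)
  have l2 := log_div_le (a := 1 + 3 * u / 4) (b := 1 + u) (by positivity) (by positivity)
  have l3 := log_div_le (a := 3 + u) (b := 3 + 3 * u) (by positivity) (by positivity)
  have m1 : (1 + u / 2 - (1 + u / 4)) / (1 + u / 4) ≤ u / 4 := by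
    rw [div_le_iff₀ (by positivity)]; nlinarith
  have m2 : (1 + u - (1 + 3 * u / 4)) / (1 + 3 * u / 4) ≤ u / 4 := by
    rw [div_le_iff₀ (by positivity)]; nlinarith
  have m3 : (3 + 3 * u - (3 + u)) / (3 + u) ≤ 2 / 3 * u := by
    rw [div_le_iff₀ (by positivity)]; nlinarith
  rw [abs_le] at b1 b2 b3 ⊢
  rw [fluctF, e1, e2, e3, e4, e5]
  constructor <;> linarith

/-- Halving 3+u and 4+u gives the pairing (1+u, (3+u)/2), ((4+u)/2, 2+u), (3+3u, 4+3u), whose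
logarithmic gaps sum exactly to `logF u`. -/
lemma abs_fluctF_le_of_le_one {x u : ℝ} (hx : 0 < x) (hu : 0 ≤ u) (hu1 : u ≤ 1) :
    |fluctF x u| ≤ 0.0000145 * logF u := by
  have e1 := fluct_mul_half (x := x) (a := 3 / 2 + u / 2) (b := 3 + u) hx (by positivity) (by ring)
  have e2 := fluct_mul_half (x := x) (a := 2 + u / 2) (b := 4 + u) hx (by positivity) (by ring)
  have b1 := abs_fluct_mul_sub_le (x := x) (a := 1 + u) (b := 3 / 2 + u / 2) hx (by positivity) (by linarith)
  have b2 := abs_fluct_mul_sub_le (x := x) (a := 2 + u / 2) (b := 2 + u) hx (by positivity) (by linarith)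
  have b3 := abs_fluct_mul_sub_le (x := x) (a := 3 + 3 * u) (b := 4 + 3 * u) hx (by positivity) (by linarith)
  have e : logF u = Real.log ((3 / 2 + u / 2) / (1 + u)) + Real.log ((2 + u) / (2 + u / 2))
      + Real.log ((4 + 3 * u) / (3 + 3 * u)) := by
    rw [logF_eq hu, show 3 / 2 + u / 2 = (3 + u) / 2 by ring, show 2 + u / 2 = (4 + u) / 2 by ring]
    repeat rw [Real.log_div (by positivity) (by positivity)]
    ring
  rw [e]
  rw [abs_le] at b1 b2 b3 ⊢
  rw [fluctF, e1, e2]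
  constructor <;> linarith

/-- The pairing is the one that gives `logF u` for u ≤ 1, but (3+u)/2 now lies below 1+u; reversing
that gap adds twice its length. -/
lemma abs_fluctF_le_of_one_le {x u : ℝ} (hx : 0 < x) (hu : 1 ≤ u) :
    |fluctF x u| ≤ 0.0000145 * (logF u + 2 * Real.log (2 * (1 + u) / (3 + u))) := by
  have hu0 : 0 ≤ u := by linarith
  have e1 := fluct_mul_half (x := x) (a := 3 / 2 + u / 2) (b := 3 + u) hx (by positivity) (by ring)
  have e2 := fluct_mul_half (x := x) (a := 2 + u / 2) (b := 4 + u) hx (by positivity) (by ring)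
  have b1 := abs_fluct_mul_sub_le (x := x) (a := 3 / 2 + u / 2) (b := 1 + u) hx (by positivity) (by linarith)
  have b2 := abs_fluct_mul_sub_le (x := x) (a := 2 + u / 2) (b := 2 + u) hx (by positivity) (by linarith)
  have b3 := abs_fluct_mul_sub_le (x := x) (a := 3 + 3 * u) (b := 4 + 3 * u) hx (by positivity) (by linarith)
  have e : logF u + 2 * Real.log (2 * (1 + u) / (3 + u))
      = Real.log ((1 + u) / (3 / 2 + u / 2)) + Real.log ((2 + u) / (2 + u / 2))
      + Real.log ((4 + 3 * u) / (3 + 3 * u)) := by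
    rw [logF_eq hu0, show 3 / 2 + u / 2 = (3 + u) / 2 by ring, show 2 + u / 2 = (4 + u) / 2 by ring]
    repeat rw [Real.log_div (by positivity) (by positivity)]
    rw [Real.log_mul (by positivity) (by positivity)]
    ring
  rw [e]
  rw [abs_le] at b1 b2 b3 ⊢
  rw [fluctF, e1, e2]
  constructor <;> linarith

lemma abs_fluctF_le_large {x u : ℝ} (hx : 0 < x) (hu : 0 ≤ u) :
    |fluctF x u| ≤ 0.0000145 * (Real.log ((2 + u) / (1 + u)) + Real.log ((4 + 3 * u) / (3 + 3 * u))
      + Real.log ((4 + u) / (3 + u))) := by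
  have b1 := abs_fluct_mul_sub_le (x := x) (a := 1 + u) (b := 2 + u) hx (by positivity) (by linarith)
  have b2 := abs_fluct_mul_sub_le (x := x) (a := 3 + u) (b := 4 + u) hx (by positivity) (by linarith)
  have b3 := abs_fluct_mul_sub_le (x := x) (a := 3 + 3 * u) (b := 4 + 3 * u) hx (by positivity) (by linarith)
  rw [abs_le] at b1 b2 b3 ⊢
  rw [fluctF]
  constructor <;> linarith

/-- A single majorant is needed that vanishes at 0, decays like 1/u and integrates in closed form
against powers of 1/(1+0.95u). Four ranges of u use the four preceding ways to estimate the
fluctuation. -/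
lemma abs_fluctF_le {x u : ℝ} (hx : 0 < x) (hu : 0 ≤ u) :
    |fluctF x u| ≤ 0.0000145 * (2.5 * u / (1 + 0.95 * u) ^ 2) := by
  have hW : 0 < 1 + 0.95 * u := by positivity
  have hl := Real.log_two_lt_d9
  rcases le_total u 0.45 with h1 | h1
  · refine (abs_fluctF_le_small hx hu).trans ?_
    gcongr
    rw [le_div_iff₀ (by positivity)]
    have : (1 + 0.95 * u) ^ 2 ≤ 2.1 := by nlinarith
    nlinarith
  rcases le_total u 1 with h2 | h2
  · refine (abs_fluctF_le_of_le_one hx hu h2).trans ?_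
    gcongr
    refine (logF_le hu).trans ?_
    rw [div_le_div_iff₀ hW (by positivity)]
    have : Real.log 2 * (1 + 0.95 * u) ≤ 2.5 * u := by nlinarith
    nlinarith
  rcases le_total u 1.9 with h3 | h3
  · refine (abs_fluctF_le_of_one_le hx h2).trans ?_
    gcongr
    have a := log_le_half_sub_inv (y := 2 * (1 + u) / (3 + u)) (by
      rw [le_div_iff₀ (by positivity)]; linarith)
    have b := logF_le hu
    have c : Real.log 2 / (1 + 0.95 * u) ≤ 0.69315 / (1 + 0.95 * u) := by gcongr; linarith
    have key : 0.69315 / (1 + 0.95 * u) + (2 * (1 + u) / (3 + u) - (2 * (1 + u) / (3 + u))⁻¹)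
        ≤ 2.5 * u / (1 + 0.95 * u) ^ 2 := by
      rw [← sub_nonneg]
      have e : 2.5 * u / (1 + 0.95 * u) ^ 2 -
          (0.69315 / (1 + 0.95 * u) + (2 * (1 + u) / (3 + u) - (2 * (1 + u) / (3 + u))⁻¹))
          = (5 * u * (1 + u) * (3 + u) - 1.3863 * (1 + 0.95 * u) * (1 + u) * (3 + u)
            - (4 * (1 + u) ^ 2 - (3 + u) ^ 2) * (1 + 0.95 * u) ^ 2)
            / (2 * (1 + u) * (3 + u) * (1 + 0.95 * u) ^ 2) := by
        field_simp
        ring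
      rw [e]
      refine div_nonneg ?_ (by positivity)
      obtain ⟨v, rfl⟩ : ∃ v, u = 1 + v := ⟨u - 1, by ring⟩
      have hv : 0 ≤ v := by linarith
      have hv1 : v ≤ 0.9 := by linarith
      have p2 : v ^ 2 ≤ 0.9 * v := by nlinarith
      have p3 : v ^ 3 ≤ 0.81 * v := by nlinarith
      have p4 : v ^ 4 ≤ 0.729 * v := by nlinarith
      nlinarith
    linarith
  · refine (abs_fluctF_le_large hx hu).trans ?_
    gcongr
    have a1 := log_succ_div_le (c := 1 + u) (by linarith)
    have a2 := log_succ_div_le (c := 3 + 3 * u) (by linarith)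
    have a3 := log_succ_div_le (c := 3 + u) (by linarith)
    rw [show 1 + u + 1 = 2 + u by ring] at a1
    rw [show 3 + 3 * u + 1 = 4 + 3 * u by ring] at a2
    rw [show 3 + u + 1 = 4 + u by ring] at a3
    have key : (1 / (1 + u) + 1 / (2 + u)) / 2 + (1 / (3 + 3 * u) + 1 / (4 + 3 * u)) / 2
        + (1 / (3 + u) + 1 / (4 + u)) / 2 ≤ 2.5 * u / (1 + 0.95 * u) ^ 2 := by
      rw [← sub_nonneg]
      have e : 2.5 * u / (1 + 0.95 * u) ^ 2 - ((1 / (1 + u) + 1 / (2 + u)) / 2 +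
          (1 / (3 + 3 * u) + 1 / (4 + 3 * u)) / 2 + (1 / (3 + u) + 1 / (4 + u)) / 2)
          = (15 * u * ((1 + u) * (2 + u) * (4 + 3 * u) * (3 + u) * (4 + u))
            - (4 * ((2 + u) * (4 + 3 * u) * (3 + u) * (4 + u))
              + 3 * ((1 + u) * (4 + 3 * u) * (3 + u) * (4 + u))
              + 3 * ((1 + u) * (2 + u) * (3 + u) * (4 + u))
              + 3 * ((1 + u) * (2 + u) * (4 + 3 * u) * (4 + u))
              + 3 * ((1 + u) * (2 + u) * (4 + 3 * u) * (3 + u))) * (1 + 0.95 * u) ^ 2)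
            / (6 * (1 + u) * (2 + u) * (4 + 3 * u) * (3 + u) * (4 + u) * (1 + 0.95 * u) ^ 2) := by
        rw [show 3 + 3 * u = 3 * (1 + u) by ring]
        field_simp
        ring
      rw [e]
      refine div_nonneg ?_ (by positivity)
      -- Expanded in v = u - 1.9, the numerator has only nonnegative coefficients.
      obtain ⟨v, rfl⟩ : ∃ v, u = 1.9 + v := ⟨u - 1.9, by ring⟩
      have hv : 0 ≤ v := by linarith
      ring_nf
      positivity
    linarith

/-! ### Laplace transform of a cell with Poisson load -/

/-- The contribution of a cell to the reciprocal of `indicator`. -/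
noncomputable def cellValue (c : ℕ × Bool) : ℝ :=
  (2 : ℝ) ^ (-(c.1 : ℤ)) + (1 - (c.2.toNat : ℝ)) * (2 : ℝ) ^ (-(c.1 : ℤ) + 1)

/-- The law of the content of a cell that has received a `Poisson(x)` number of elements. -/
noncomputable def cellLaw (x : ℝ) (c : ℕ × Bool) : ℝ :=
  Real.exp (-(x * 2 ^ (-(c.1 : ℤ)))) *
    (1 - (if c.1 = 0 then 0 else 1) * Real.exp (-(x * 2 ^ (-(c.1 : ℤ))))) *
    ((if c.2 then 1 else 0) + (if c.2 then -1 else 1) * (if c.1 ≤ 1 then 0 else 1) *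
      Real.exp (-(x * 2 ^ (-(c.1 : ℤ) + 1))))

lemma cellLaw_nonneg {x : ℝ} (hx : 0 ≤ x) (c : ℕ × Bool) : 0 ≤ cellLaw x c := by
  have h1 : Real.exp (-(x * 2 ^ (-(c.1 : ℤ)))) ≤ 1 := Real.exp_le_one_iff.2 (by
    have : 0 ≤ x * (2:ℝ) ^ (-(c.1 : ℤ)) := by positivity
    linarith)
  have h2 : Real.exp (-(x * 2 ^ (-(c.1 : ℤ) + 1))) ≤ 1 := Real.exp_le_one_iff.2 (by
    have : 0 ≤ x * (2:ℝ) ^ (-(c.1 : ℤ) + 1) := by positivity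
    linarith)
  have h3 := Real.exp_pos (-(x * 2 ^ (-(c.1 : ℤ) + 1)))
  rw [cellLaw]
  refine mul_nonneg (mul_nonneg (Real.exp_pos _).le ?_) ?_
  · split_ifs <;> linarith
  · split_ifs <;> linarith

/-- The contribution of the counter value `k` to the Laplace transform of `cellValue`, at
`y = x 2^{-k}` and the argument `x u`, for `2 ≤ k`. -/
noncomputable def levelTerm (u y : ℝ) : ℝ :=
  Real.exp (-y) * (1 - Real.exp (-y)) *
    ((1 - Real.exp (-(2 * y))) * Real.exp (-(u * y)) + Real.exp (-(2 * y)) * Real.exp (-(3 * u * y)))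

lemma levelTerm_eq (u y : ℝ) : levelTerm u y =
    (Real.exp (-((1 + u) * y)) - Real.exp (-((2 + u) * y)))
    - (Real.exp (-((3 + u) * y)) - Real.exp (-((4 + u) * y)))
    + (Real.exp (-((3 + 3 * u) * y)) - Real.exp (-((4 + 3 * u) * y))) := by
  rw [levelTerm]
  have e1 : Real.exp (-((1 + u) * y)) = Real.exp (-y) * Real.exp (-(u * y)) := by
    rw [← Real.exp_add]; ring_nf
  have e2 : Real.exp (-((2 + u) * y)) = Real.exp (-y) ^ 2 * Real.exp (-(u * y)) := by
    rw [← Real.exp_nat_mul, ← Real.exp_add]; push_cast; ring_nf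
  have e3 : Real.exp (-((3 + u) * y)) = Real.exp (-y) ^ 3 * Real.exp (-(u * y)) := by
    rw [← Real.exp_nat_mul, ← Real.exp_add]; push_cast; ring_nf
  have e4 : Real.exp (-((4 + u) * y)) = Real.exp (-y) ^ 4 * Real.exp (-(u * y)) := by
    rw [← Real.exp_nat_mul, ← Real.exp_add]; push_cast; ring_nf
  have e5 : Real.exp (-((3 + 3 * u) * y)) = Real.exp (-y) ^ 3 * Real.exp (-(3 * u * y)) := by
    rw [← Real.exp_nat_mul, ← Real.exp_add]; push_cast; ring_nf
  have e6 : Real.exp (-((4 + 3 * u) * y)) = Real.exp (-y) ^ 4 * Real.exp (-(3 * u * y)) := by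
    rw [← Real.exp_nat_mul, ← Real.exp_add]; push_cast; ring_nf
  have e7 : Real.exp (-(2 * y)) = Real.exp (-y) ^ 2 := by
    rw [← Real.exp_nat_mul]; push_cast; ring_nf
  rw [e1, e2, e3, e4, e5, e6, e7]
  ring

lemma exp_neg_le_inv {z : ℝ} (hz : 0 < z) : Real.exp (-z) ≤ z⁻¹ := by
  rw [Real.exp_neg]
  exact inv_anti₀ hz (by linarith [Real.add_one_le_exp z])

lemma levelTerm_nonneg {u y : ℝ} (hy : 0 ≤ y) : 0 ≤ levelTerm u y := by
  have h1 : Real.exp (-y) ≤ 1 := Real.exp_le_one_iff.2 (by linarith)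
  have h2 : Real.exp (-(2 * y)) ≤ 1 := Real.exp_le_one_iff.2 (by linarith)
  rw [levelTerm]
  refine mul_nonneg (mul_nonneg (Real.exp_pos _).le (by linarith)) (add_nonneg ?_ (by positivity))
  exact mul_nonneg (by linarith) (Real.exp_pos _).le

lemma levelTerm_le {u y : ℝ} (hu : 0 ≤ u) (hy : 0 < y) : levelTerm u y ≤ ((1 + u) * y)⁻¹ * 2 := by
  have h := exp_neg_le_inv (z := (1 + u) * y) (by positivity)
  have h1 : Real.exp (-((4 + u) * y)) ≤ Real.exp (-((3 + u) * y)) := Real.exp_le_exp.2 (by nlinarith)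
  have h2 : Real.exp (-((3 + 3 * u) * y)) ≤ Real.exp (-((1 + u) * y)) :=
    Real.exp_le_exp.2 (by nlinarith [mul_nonneg hu hy.le])
  have h3 := Real.exp_pos (-((2 + u) * y))
  have h4 := Real.exp_pos (-((4 + 3 * u) * y))
  rw [levelTerm_eq]
  linarith

/-- Expanding the product turns a level into three exponential differences, so the sum over all
integers k is exact: main term f(u) plus fluctuation. -/
lemma hasSum_levelTerm {x u : ℝ} (hx : 0 < x) (hu : 0 ≤ u) :
    HasSum (fun k : ℤ => levelTerm u (x * 2 ^ k)) (f u + fluctF x u) := by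
  have h : ∀ a b : ℝ, 0 < a → 0 < b →
      HasSum (fun k : ℤ => Real.exp (-(a * (x * 2 ^ k))) - Real.exp (-(b * (x * 2 ^ k))))
        (Real.logb 2 (b / a) + (fluct (x * b) - fluct (x * a))) := fun a b ha hb => by
    have h1 := (summable_exp_sub_exp (mul_pos hx ha) (mul_pos hx hb)).hasSum
    rw [← expDiff, expDiff_eq (mul_pos hx ha) (mul_pos hx hb), mul_div_mul_left _ _ hx.ne'] at h1
    convert h1 using 5 <;> ring
  have := ((h (1 + u) (2 + u) (by positivity) (by positivity)).sub
    (h (3 + u) (4 + u) (by positivity) (by positivity))).add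
    (h (3 + 3 * u) (4 + 3 * u) (by positivity) (by positivity))
  have e : f u + fluctF x u =
      Real.logb 2 ((2 + u) / (1 + u)) + (fluct (x * (2 + u)) - fluct (x * (1 + u))) -
      (Real.logb 2 ((4 + u) / (3 + u)) + (fluct (x * (4 + u)) - fluct (x * (3 + u)))) +
      (Real.logb 2 ((4 + 3 * u) / (3 + 3 * u)) +
        (fluct (x * (4 + 3 * u)) - fluct (x * (3 + 3 * u)))) := by
    rw [f, fluctF]; ring
  simp only [levelTerm_eq]
  rw [e]
  exact this

/-- The Laplace transform of `cellValue` for a cell that has received a `Poisson(x)` number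
of elements. -/
noncomputable def cellTransform (x t : ℝ) : ENNReal :=
  ∑' c : ℕ × Bool, ENNReal.ofReal (cellLaw x c * Real.exp (-(t * cellValue c)))

lemma measurable_cellTransform (x : ℝ) : Measurable (cellTransform x) := by
  unfold cellTransform
  refine Measurable.tsum fun c => ?_
  fun_prop

/-- The contribution of the counter value `k` to the Laplace transform. -/
noncomputable def counterTerm (x u : ℝ) (k : ℕ) : ℝ :=
  cellLaw x (k, true) * Real.exp (-(x * u * cellValue (k, true))) +
    cellLaw x (k, false) * Real.exp (-(x * u * cellValue (k, false)))

lemma counterTerm_nonneg {x : ℝ} (hx : 0 ≤ x) (u : ℝ) (k : ℕ) : 0 ≤ counterTerm x u k :=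
  add_nonneg (mul_nonneg (cellLaw_nonneg hx _) (Real.exp_pos _).le)
    (mul_nonneg (cellLaw_nonneg hx _) (Real.exp_pos _).le)

lemma counterTerm_zero (x u : ℝ) : counterTerm x u 0 = Real.exp (-(x * (1 + u))) := by
  rw [show -(x * (1 + u)) = -x + -(x * u) by ring, Real.exp_add]
  simp [counterTerm, cellLaw, cellValue]

lemma counterTerm_one_le {x u : ℝ} (hx : 0 < x) (hu : 0 ≤ u) :
    counterTerm x u 1 ≤ (x * (1 + u))⁻¹ * 2 := by
  have h := exp_neg_le_inv (z := x * (1 + u) / 2) (by positivity)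
  have e : counterTerm x u 1 =
      Real.exp (-(x * 2⁻¹)) * (1 - Real.exp (-(x * 2⁻¹))) * Real.exp (-(x * u * 2⁻¹)) := by
    simp [counterTerm, cellLaw, cellValue]
  have h1 := Real.exp_pos (-(x * 2⁻¹))
  have e2 : Real.exp (-(x * 2⁻¹)) * Real.exp (-(x * u * 2⁻¹)) = Real.exp (-(x * (1 + u) / 2)) := by
    rw [← Real.exp_add]; ring_nf
  have e3 : (x * (1 + u) / 2)⁻¹ = (x * (1 + u))⁻¹ * 2 := by rw [inv_div]; ring
  rw [e, ← e3]
  refine le_trans ?_ h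
  rw [← e2]
  gcongr
  nlinarith

lemma counterTerm_add_two (x u : ℝ) (k : ℕ) :
    counterTerm x u (k + 2) = levelTerm u (x * 2 ^ (-((k + 2 : ℕ) : ℤ))) := by
  have h2 : (2:ℝ) ^ (-((k + 2 : ℕ) : ℤ) + 1) = 2 * 2 ^ (-((k + 2 : ℕ) : ℤ)) := by
    rw [zpow_add_one₀ two_ne_zero, mul_comm]
  simp only [counterTerm, cellLaw, cellValue, levelTerm, h2]
  generalize (2:ℝ) ^ (-((k + 2 : ℕ) : ℤ)) = z
  have e1 : Real.exp (-(x * u * (z + (1 - ((true.toNat : ℕ) : ℝ)) * (2 * z)))) = Real.exp (-(u * (x * z))) := by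
    simp only [Bool.toNat_true]; congr 1; push_cast; ring
  have e2 : Real.exp (-(x * u * (z + (1 - ((false.toNat : ℕ) : ℝ)) * (2 * z)))) = Real.exp (-(3 * u * (x * z))) := by
    simp only [Bool.toNat_false]; congr 1; push_cast; ring
  rw [e1, e2, show x * (2 * z) = 2 * (x * z) by ring]
  simp
  ring

/-- The true counter runs over k ≥ 0 and agrees with `levelTerm` only for k ≥ 2. Replacing the
levels 0 and 1 costs 2z and 4z, and including the negative levels costs 2z, where z = 1/(x(1+u)). -/
lemma cellTransform_eq {x u : ℝ} (hx : 0 < x) (hu : 0 ≤ u) :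
    ∃ T : ℝ, 0 ≤ T ∧ cellTransform x (x * u) = ENNReal.ofReal T ∧
      |T - (f u + fluctF x u)| ≤ 8 * (x * (1 + u))⁻¹ := by
  set z := (x * (1 + u))⁻¹ with hz
  have hz0 : 0 < z := by positivity
  have hH := hasSum_levelTerm hx hu
  have i1 : Function.Injective fun n : ℕ => -(n : ℤ) := fun a b h => by
    have h' : -(a : ℤ) = -(b : ℤ) := h
    omega
  have i2 : Function.Injective fun n : ℕ => (n : ℤ) + 1 := fun a b h => by
    have h' : (a : ℤ) + 1 = (b : ℤ) + 1 := h
    omega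
  have s1 : Summable fun n : ℕ => levelTerm u (x * 2 ^ (-(n : ℤ))) := hH.summable.comp_injective i1
  have s2 : Summable fun n : ℕ => levelTerm u (x * 2 ^ ((n : ℤ) + 1)) := hH.summable.comp_injective i2
  have h12 : (∑' n : ℕ, levelTerm u (x * 2 ^ (-(n : ℤ))))
      + ∑' n : ℕ, levelTerm u (x * 2 ^ ((n : ℤ) + 1)) = f u + fluctF x u := by
    have hH' := (Equiv.neg ℤ).hasSum_iff.2 hH
    refine (HasSum.of_nat_of_neg_add_one (f := (fun k : ℤ => levelTerm u (x * 2 ^ k)) ∘ Equiv.neg ℤ)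
      s1.hasSum ?_).unique hH'
    convert s2.hasSum using 5
    simp
  have b2 : ∑' n : ℕ, levelTerm u (x * 2 ^ ((n : ℤ) + 1)) ≤ 2 * z := by
    have hg : HasSum (fun n : ℕ => z * ((1 / 2 : ℝ) ^ n)) (z * 2) := hasSum_geometric_two.mul_left z
    rw [mul_comm, ← hg.tsum_eq]
    refine s2.tsum_le_tsum (fun n => ?_) hg.summable
    refine (levelTerm_le hu (by positivity)).trans (le_of_eq ?_)
    rw [hz, zpow_add_one₀ two_ne_zero, zpow_natCast, one_div, inv_pow]
    field_simp
  have b2' : 0 ≤ ∑' n : ℕ, levelTerm u (x * 2 ^ ((n : ℤ) + 1)) :=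
    tsum_nonneg fun n => levelTerm_nonneg (by positivity)
  have c0 : |counterTerm x u 0 - levelTerm u (x * 2 ^ (-((0 : ℕ) : ℤ)))| ≤ 2 * z := by
    have a1 : counterTerm x u 0 ≤ z := by
      rw [counterTerm_zero]; exact exp_neg_le_inv (by positivity)
    have a2 := counterTerm_nonneg hx.le u 0
    have a3 : levelTerm u (x * 2 ^ (-((0 : ℕ) : ℤ))) ≤ 2 * z := by
      refine (levelTerm_le hu (by positivity)).trans (le_of_eq ?_)
      simp [hz]; ring
    have a4 : 0 ≤ levelTerm u (x * 2 ^ (-((0 : ℕ) : ℤ))) := levelTerm_nonneg (by positivity)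
    rw [abs_le]; constructor <;> linarith
  have c1 : |counterTerm x u 1 - levelTerm u (x * 2 ^ (-((1 : ℕ) : ℤ)))| ≤ 4 * z := by
    have a1 := counterTerm_one_le hx hu
    rw [← hz] at a1
    have a2 := counterTerm_nonneg hx.le u 1
    have a3 : levelTerm u (x * 2 ^ (-((1 : ℕ) : ℤ))) ≤ 4 * z := by
      refine (levelTerm_le hu (by positivity)).trans (le_of_eq ?_)
      simp [hz]; ring
    have a4 : 0 ≤ levelTerm u (x * 2 ^ (-((1 : ℕ) : ℤ))) := levelTerm_nonneg (by positivity)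
    rw [abs_le]; constructor <;> linarith
  have s3 : Summable (counterTerm x u) := by
    refine (summable_nat_add_iff 2).1 ?_
    simp only [counterTerm_add_two]
    exact (summable_nat_add_iff (f := fun n : ℕ => levelTerm u (x * 2 ^ (-(n : ℤ)))) 2).2 s1
  refine ⟨∑' k, counterTerm x u k, tsum_nonneg (counterTerm_nonneg hx.le u), ?_, ?_⟩
  · rw [ENNReal.ofReal_tsum_of_nonneg (counterTerm_nonneg hx.le u) s3, cellTransform,
      ENNReal.tsum_prod']
    congr 1 with k
    rw [tsum_bool, counterTerm, ENNReal.ofReal_add, add_comm]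
    · exact mul_nonneg (cellLaw_nonneg hx.le _) (Real.exp_pos _).le
    · exact mul_nonneg (cellLaw_nonneg hx.le _) (Real.exp_pos _).le
  · rw [← h12, ← s3.sum_add_tsum_nat_add 2, ← s1.sum_add_tsum_nat_add 2]
    simp only [counterTerm_add_two, Finset.sum_range_succ, Finset.sum_range_zero]
    rw [abs_le] at c0 c1 ⊢
    constructor <;> linarith

/-! ### The integral in the Poisson model -/

open Filter Topology in
lemma integral_inv_one_add_mul_pow {b : ℝ} (hb : 0 < b) (p : ℕ) :
    IntegrableOn (fun u : ℝ => ((1 + b * u) ^ (p + 2))⁻¹) (Set.Ioi 0) ∧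
      ∫ u in Set.Ioi (0:ℝ), ((1 + b * u) ^ (p + 2))⁻¹ = 1 / (b * (p + 1)) := by
  have hd : ∀ u ∈ Set.Ici (0:ℝ), HasDerivAt (fun u : ℝ => -(b * (p + 1))⁻¹ * ((1 + b * u) ^ (p + 1))⁻¹)
      (((1 + b * u) ^ (p + 2))⁻¹) u := fun u hu => by
    have hu' : (0:ℝ) ≤ u := hu
    have h0 : (1 + b * u) ≠ 0 := by positivity
    have h1 : HasDerivAt (fun u : ℝ => 1 + b * u) b u := by
      simpa using ((hasDerivAt_id u).const_mul b).const_add 1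
    refine (((h1.fun_pow (p + 1)).fun_inv (by positivity)).const_mul _).congr_deriv ?_
    simp only [Nat.add_sub_cancel]
    push_cast
    field_simp
    ring
  have hpos : ∀ u ∈ Set.Ioi (0:ℝ), 0 ≤ ((1 + b * u) ^ (p + 2))⁻¹ := fun u hu => by
    have hu' : (0:ℝ) < u := hu
    positivity
  have ht : Tendsto (fun u : ℝ => -(b * (p + 1))⁻¹ * ((1 + b * u) ^ (p + 1))⁻¹) atTop (𝓝 0) := by
    have h1 : Tendsto (fun u : ℝ => 1 + b * u) atTop atTop :=
      tendsto_atTop_add_const_left _ _ (tendsto_id.const_mul_atTop hb)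
    have h2 := (tendsto_pow_atTop (α := ℝ) (n := p + 1) (by omega)).comp h1
    simpa using h2.inv_tendsto_atTop.const_mul (-(b * (p + 1))⁻¹)
  refine ⟨integrableOn_Ioi_deriv_of_nonneg' hd hpos ht, ?_⟩
  rw [integral_Ioi_of_hasDerivAt_of_nonneg' hd hpos ht]
  simp

lemma integral_mul_inv_one_add_mul_pow {b : ℝ} (hb : 0 < b) (p : ℕ) :
    IntegrableOn (fun u : ℝ => u * ((1 + b * u) ^ (p + 3))⁻¹) (Set.Ioi 0) ∧
      ∫ u in Set.Ioi (0:ℝ), u * ((1 + b * u) ^ (p + 3))⁻¹ = 1 / (b ^ 2 * ((p + 1) * (p + 2))) := by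
  obtain ⟨i1, e1⟩ := integral_inv_one_add_mul_pow hb p
  obtain ⟨i2, e2⟩ := integral_inv_one_add_mul_pow hb (p + 1)
  have e : Set.EqOn (fun u : ℝ => b⁻¹ * (((1 + b * u) ^ (p + 2))⁻¹ - ((1 + b * u) ^ (p + 1 + 2))⁻¹))
      (fun u : ℝ => u * ((1 + b * u) ^ (p + 3))⁻¹) (Set.Ioi 0) := fun u hu => by
    have hu' : (0:ℝ) < u := hu
    have h0 : (1 + b * u) ≠ 0 := by positivity
    simp only
    rw [show p + 1 + 2 = p + 2 + 1 by ring, show p + 3 = p + 2 + 1 by ring, pow_succ _ (p + 2)]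
    field_simp
    ring
  refine ⟨(integrableOn_congr_fun e measurableSet_Ioi).1 ((i1.sub i2).const_mul _), ?_⟩
  rw [← setIntegral_congr_fun measurableSet_Ioi e, integral_const_mul, integral_sub i1 i2, e1, e2]
  push_cast
  field_simp
  ring

lemma continuousOn_f : ContinuousOn f (Set.Ioi 0) := by
  unfold f Real.logb
  have : ∀ a b c d : ℝ, 0 < a → 0 ≤ b → 0 < c → 0 ≤ d →
      ContinuousOn (fun u : ℝ => Real.log ((a + b * u) / (c + d * u)) / Real.log 2) (Set.Ioi 0) := by
    intro a b c d ha hb hc hd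
    refine ContinuousOn.div_const (ContinuousOn.log (ContinuousOn.div (by fun_prop) (by fun_prop) ?_) ?_) _
    · intro u hu
      have hu' : (0:ℝ) < u := hu
      exact (by positivity : 0 < c + d * u).ne'
    · intro u hu
      have hu' : (0:ℝ) < u := hu
      exact (div_pos (by positivity : 0 < a + b * u) (by positivity : 0 < c + d * u)).ne'
  have h1 := this 2 1 1 1 (by norm_num) (by norm_num) (by norm_num) (by norm_num)
  have h2 := this 4 3 3 3 (by norm_num) (by norm_num) (by norm_num) (by norm_num)
  have h3 := this 4 1 3 1 (by norm_num) (by norm_num) (by norm_num) (by norm_num)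
  simp only [one_mul] at h1 h3
  exact (h1.add h2).sub h3

lemma integrableOn_f_pow {m : ℕ} (hm : 2 ≤ m) :
    IntegrableOn (fun u : ℝ => f u ^ m) (Set.Ioi 0) := by
  obtain ⟨p, rfl⟩ := Nat.exists_eq_add_of_le' hm
  refine (integral_inv_one_add_mul_pow (b := 0.95) (by norm_num) p).1.mono'
    ((continuousOn_f.pow _).aestronglyMeasurable measurableSet_Ioi) ?_
  refine (ae_restrict_iff' measurableSet_Ioi).2 (Filter.Eventually.of_forall fun u hu => ?_)
  have hu' : (0:ℝ) ≤ u := le_of_lt hu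
  rw [norm_pow, Real.norm_of_nonneg (f_nonneg hu'), ← inv_pow]
  gcongr
  · exact f_nonneg hu'
  · simpa using f_le hu'

/-- The normalized expectation of `indicator` in the Poisson model with load `x` per cell. -/
noncomputable def poissonIntegral (m : ℕ) (x : ℝ) : ENNReal :=
  ∫⁻ u in Set.Ioi (0:ℝ), cellTransform x (x * u) ^ m

lemma abs_f_add_fluctF_pow_sub_le {x u : ℝ} (hx : 0 < x) (hu : 0 ≤ u) (p : ℕ) :
    |(f u + fluctF x u) ^ (p + 2) - f u ^ (p + 2)|
      ≤ (p + 2) * (0.0000145 * 2.5) * (u * ((1 + 0.9499 * u) ^ (p + 3))⁻¹) ∧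
    |f u + fluctF x u| ≤ (1 + 0.9499 * u)⁻¹ := by
  have hf0 := f_nonneg hu
  have hf1 := f_le hu
  have hw := abs_fluctF_le hx hu
  have hW : 0 < 1 + 0.95 * u := by positivity
  have hV : 0 < 1 + 0.9499 * u := by positivity
  have hH : f u + |fluctF x u| ≤ (1 + 0.9499 * u)⁻¹ := by
    have : 1 / (1 + 0.95 * u) + 0.0000145 * (2.5 * u / (1 + 0.95 * u) ^ 2) ≤ (1 + 0.9499 * u)⁻¹ := by
      -- The loss of 0.0001 in the slope absorbs the fluctuation, since 0.0000145·2.5 = 0.00003625 <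
      -- 0.0001.
      rw [← sub_nonneg]
      have e : (1 + 0.9499 * u)⁻¹ - (1 / (1 + 0.95 * u) + 0.0000145 * (2.5 * u / (1 + 0.95 * u) ^ 2))
          = u * (0.0001 * (1 + 0.95 * u) - 0.00003625 * (1 + 0.9499 * u)) /
            ((1 + 0.9499 * u) * (1 + 0.95 * u) ^ 2) := by
        field_simp
        ring
      rw [e]
      refine div_nonneg (mul_nonneg hu ?_) (by positivity)
      linarith
    linarith
  have hHa : |f u + fluctF x u| ≤ (1 + 0.9499 * u)⁻¹ :=
    (abs_add_le _ _).trans (by rwa [abs_of_nonneg hf0])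
  refine ⟨?_, hHa⟩
  have hfa : |f u| ≤ (1 + 0.9499 * u)⁻¹ := by
    rw [abs_of_nonneg hf0]; linarith [abs_nonneg (fluctF x u)]
  refine (abs_pow_sub_pow_le _ _ _).trans ?_
  rw [add_sub_cancel_left, show p + 2 - 1 = p + 1 by omega]
  calc |fluctF x u| * ((p + 2 : ℕ) : ℝ) * max |f u + fluctF x u| |f u| ^ (p + 1)
      ≤ (0.0000145 * (2.5 * u / (1 + 0.9499 * u) ^ 2)) * ((p + 2 : ℕ) : ℝ) * ((1 + 0.9499 * u)⁻¹) ^ (p + 1) := by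
        have h1 : 0.0000145 * (2.5 * u / (1 + 0.95 * u) ^ 2) ≤ 0.0000145 * (2.5 * u / (1 + 0.9499 * u) ^ 2) := by
          gcongr; norm_num
        gcongr
        · exact hw.trans h1
        · exact max_le hHa hfa
    _ = _ := by
        push_cast
        rw [inv_pow, show p + 3 = 2 + (p + 1) by ring, pow_add]
        field_simp
        ring

lemma abs_transform_pow_sub_le {x u T : ℝ} (hx : 1 ≤ x) (hu : 0 ≤ u) (hT0 : 0 ≤ T)
    (hT : |T - (f u + fluctF x u)| ≤ 8 * (x * (1 + u))⁻¹) (p : ℕ) :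
    |T ^ (p + 2) - (f u + fluctF x u) ^ (p + 2)|
      ≤ (8 * (p + 2) * 10 ^ (p + 1) / x) * ((1 + 1 * u) ^ (p + 2))⁻¹ := by
  have hx0 : 0 < x := by linarith
  have hH := (abs_f_add_fluctF_pow_sub_le hx0 hu p).2
  have h1 : (1 + 0.9499 * u)⁻¹ ≤ 2 * (1 + u)⁻¹ := by
    rw [← div_eq_mul_inv, inv_eq_one_div, div_le_div_iff₀ (by positivity) (by positivity)]
    linarith
  have h2 : (x * (1 + u))⁻¹ ≤ (1 + u)⁻¹ := inv_anti₀ (by positivity) (by nlinarith)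
  have h3 : 0 ≤ (1 + u)⁻¹ := by positivity
  -- The constant 10 is 8 from the transform error (using x ≥ 1) plus 2 from the bound on f plus
  -- fluctuation.
  have hTa : |T| ≤ 10 * (1 + u)⁻¹ := by
    rw [abs_of_nonneg hT0]
    rw [abs_le] at hT hH
    linarith
  refine (abs_pow_sub_pow_le _ _ _).trans ?_
  rw [show p + 2 - 1 = p + 1 by omega]
  calc |T - (f u + fluctF x u)| * ((p + 2 : ℕ) : ℝ) * max |T| |f u + fluctF x u| ^ (p + 1)
      ≤ (8 * (x * (1 + u))⁻¹) * ((p + 2 : ℕ) : ℝ) * (10 * (1 + u)⁻¹) ^ (p + 1) := by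
        gcongr
        exact max_le hTa (by linarith)
    _ = _ := by
        push_cast
        rw [one_mul, mul_pow, inv_pow, show p + 2 = 1 + (p + 1) by ring, pow_add]
        field_simp
        ring

/-- The m-th powers are compared pointwise in two stages, transform against f plus fluctuation, then
that against f. The first error is O(1/x); the second persists and gives the constant of the
theorem. -/
lemma poissonIntegral_bound {m : ℕ} (hm : 2 ≤ m) {x : ℝ} (hx : 1 ≤ x) :
    poissonIntegral m x ≠ ⊤ ∧
      |(poissonIntegral m x).toReal - ∫ u in Set.Ioi (0:ℝ), f u ^ m|
        ≤ 0.000084 / m + 8 * m * 10 ^ m / x := by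
  have hx0 : 0 < x := by linarith
  have hI := integrableOn_f_pow hm
  have hm0 : (2:ℝ) ≤ m := by exact_mod_cast hm
  obtain ⟨p, rfl⟩ := Nat.exists_eq_add_of_le' hm
  obtain ⟨i1, e1⟩ := integral_mul_inv_one_add_mul_pow (b := 0.9499) (by norm_num) p
  obtain ⟨i2, e2⟩ := integral_inv_one_add_mul_pow (b := 1) (by norm_num) p
  have hT : ∀ u ∈ Set.Ioi (0:ℝ), 0 ≤ (cellTransform x (x * u)).toReal ∧
      cellTransform x (x * u) = ENNReal.ofReal (cellTransform x (x * u)).toReal ∧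
      |(cellTransform x (x * u)).toReal - (f u + fluctF x u)| ≤ 8 * (x * (1 + u))⁻¹ := fun u hu => by
    obtain ⟨T, h1, h2, h3⟩ := cellTransform_eq hx0 (le_of_lt hu)
    rw [h2, ENNReal.toReal_ofReal h1]
    exact ⟨h1, rfl, h3⟩
  set B : ℝ → ℝ := fun u => ((p + 2) * (0.0000145 * 2.5)) * (u * ((1 + 0.9499 * u) ^ (p + 3))⁻¹)
    + (8 * (p + 2) * 10 ^ (p + 1) / x) * ((1 + 1 * u) ^ (p + 2))⁻¹ with hB
  have iB : IntegrableOn B (Set.Ioi 0) := (i1.const_mul _).add (i2.const_mul _)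
  have hbd : ∀ u ∈ Set.Ioi (0:ℝ), |(cellTransform x (x * u)).toReal ^ (p + 2) - f u ^ (p + 2)| ≤ B u := fun u hu => by
    obtain ⟨h1, -, h3⟩ := hT u hu
    have a1 := abs_transform_pow_sub_le hx (le_of_lt hu) h1 h3 p
    have a2 := (abs_f_add_fluctF_pow_sub_le hx0 (le_of_lt hu) p).1
    refine (abs_sub_le _ ((f u + fluctF x u) ^ (p + 2)) _).trans ?_
    simp only [hB]
    linarith
  have hmeas : Measurable fun u => (cellTransform x (x * u)).toReal ^ (p + 2) :=
    (((measurable_cellTransform x).comp (measurable_const_mul x)).ennreal_toReal).pow_const _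
  have hmeasT : AEStronglyMeasurable (fun u => (cellTransform x (x * u)).toReal ^ (p + 2))
      (volume.restrict (Set.Ioi 0)) := hmeas.aestronglyMeasurable
  have iD : IntegrableOn (fun u => (cellTransform x (x * u)).toReal ^ (p + 2) - f u ^ (p + 2)) (Set.Ioi 0) :=
    iB.mono' (hmeasT.sub hI.aestronglyMeasurable)
      ((ae_restrict_iff' measurableSet_Ioi).2 (Filter.Eventually.of_forall hbd))
  have iT : IntegrableOn (fun u => (cellTransform x (x * u)).toReal ^ (p + 2)) (Set.Ioi 0) := by
    have := iD.add hI
    simpa [Pi.add_def] using this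
  have hJ : poissonIntegral (p + 2) x
      = ENNReal.ofReal (∫ u in Set.Ioi (0:ℝ), (cellTransform x (x * u)).toReal ^ (p + 2)) := by
    rw [ofReal_integral_eq_lintegral_ofReal iT (Filter.Eventually.of_forall fun u => by positivity),
      poissonIntegral]
    refine setLIntegral_congr_fun measurableSet_Ioi fun u hu => ?_
    obtain ⟨h1, h2, -⟩ := hT u hu
    rw [ENNReal.ofReal_pow h1, ← h2]
  have h0 : 0 ≤ ∫ u in Set.Ioi (0:ℝ), (cellTransform x (x * u)).toReal ^ (p + 2) :=
    integral_nonneg fun u => by positivity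
  rw [hJ, ENNReal.toReal_ofReal h0]
  refine ⟨ENNReal.ofReal_ne_top, ?_⟩
  rw [← integral_sub iT hI, ← Real.norm_eq_abs]
  refine (norm_integral_le_of_norm_le iB
    ((ae_restrict_iff' measurableSet_Ioi).2 (Filter.Eventually.of_forall hbd))).trans ?_
  simp only [hB]
  rw [integral_add (i1.const_mul _) (i2.const_mul _), integral_const_mul, integral_const_mul, e1, e2]
  have hp : (0:ℝ) ≤ p := by positivity
  push_cast
  refine add_le_add ?_ ?_
  -- Here 0.0000145·2.5/0.9499² ≈ 4.02e-5, and m/(m-1) ≤ 2 with equality at m = 2, so 8.4e-5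
  -- suffices.
  · have : ((p:ℝ) + 2) * (0.0000145 * 2.5) * (1 / (0.9499 ^ 2 * ((p + 1) * (p + 2))))
        = (0.0000145 * 2.5 / 0.9499 ^ 2) / (p + 1) := by field_simp
    rw [this, div_le_div_iff₀ (by positivity) (by positivity)]
    nlinarith
  · rw [div_mul_eq_mul_div]
    refine div_le_div_of_nonneg_right ?_ hx0.le
    have h10 : (10:ℝ) ^ (p + 1) ≤ 10 ^ (p + 2) := pow_le_pow_right₀ (by norm_num) (by omega)
    have h11 : 1 / (1 * ((p:ℝ) + 1)) ≤ 1 := by rw [div_le_one (by positivity)]; linarith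
    calc 8 * ((p:ℝ) + 2) * 10 ^ (p + 1) * (1 / (1 * ((p:ℝ) + 1))) ≤ 8 * ((p:ℝ) + 2) * 10 ^ (p + 2) * 1 := by gcongr
      _ = _ := by ring

/-! ### Poisson moments and depoissonization -/

/-- The weights of the Poisson distribution. -/
noncomputable def poissonWeight (l : ℝ) (n : ℕ) : ℝ := Real.exp (-l) * (l ^ n / n.factorial)

lemma poissonWeight_nonneg {l : ℝ} (hl : 0 ≤ l) (n : ℕ) : 0 ≤ poissonWeight l n := by
  rw [poissonWeight]; positivity

lemma hasSum_poissonWeight_mul_pow (l q : ℝ) :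
    HasSum (fun n => poissonWeight l n * q ^ n) (Real.exp (-(l * (1 - q)))) := by
  have h := NormedSpace.expSeries_div_hasSum_exp (𝔸 := ℝ) (l * q)
  rw [← Real.exp_eq_exp_ℝ] at h
  have e1 : (fun n => poissonWeight l n * q ^ n)
      = fun n : ℕ => Real.exp (-l) * ((l * q) ^ n / n.factorial) := by
    ext n; rw [poissonWeight, mul_pow]; ring
  have e2 : Real.exp (-(l * (1 - q))) = Real.exp (-l) * Real.exp (l * q) := by
    rw [← Real.exp_add]; ring_nf
  rw [e1, e2]
  exact h.mul_left _

lemma hasSum_poissonWeight (l : ℝ) : HasSum (poissonWeight l) 1 := by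
  simpa using hasSum_poissonWeight_mul_pow l 1

lemma poissonWeight_succ (l : ℝ) (n : ℕ) :
    ((n + 1 : ℕ) : ℝ) * poissonWeight l (n + 1) = l * poissonWeight l n := by
  rw [poissonWeight, poissonWeight, Nat.factorial_succ]
  push_cast
  field_simp
  ring

lemma hasSum_mul_poissonWeight (l : ℝ) : HasSum (fun n : ℕ => (n : ℝ) * poissonWeight l n) l := by
  rw [← hasSum_nat_add_iff' 1]
  simp only [poissonWeight_succ]
  simpa using (hasSum_poissonWeight l).mul_left l

lemma hasSum_sq_mul_poissonWeight (l : ℝ) :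
    HasSum (fun n : ℕ => (n : ℝ) ^ 2 * poissonWeight l n) (l ^ 2 + l) := by
  rw [← hasSum_nat_add_iff' 1]
  have e : ∀ n : ℕ, ((n + 1 : ℕ) : ℝ) ^ 2 * poissonWeight l (n + 1)
      = l * (n * poissonWeight l n + poissonWeight l n) := fun n => by
    rw [sq, mul_assoc, poissonWeight_succ]; push_cast; ring
  simp only [e]
  have := ((hasSum_mul_poissonWeight l).add (hasSum_poissonWeight l)).mul_left l
  have e2 : l ^ 2 + l - ∑ i ∈ Finset.range 1, (i : ℝ) ^ 2 * poissonWeight l i = l * (l + 1) := by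
    simp; ring
  rwa [e2]

lemma hasSum_variance_poissonWeight (l : ℝ) :
    HasSum (fun n : ℕ => ((n : ℝ) - l) ^ 2 * poissonWeight l n) l := by
  have := ((hasSum_sq_mul_poissonWeight l).sub ((hasSum_mul_poissonWeight l).mul_left (2 * l))).add
    ((hasSum_poissonWeight l).mul_left (l ^ 2))
  have e1 : (fun n : ℕ => ((n : ℝ) - l) ^ 2 * poissonWeight l n) = fun n : ℕ =>
      (n : ℝ) ^ 2 * poissonWeight l n - 2 * l * (n * poissonWeight l n) + l ^ 2 * poissonWeight l n := by
    ext n; ring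
  have e2 : l ^ 2 + l - 2 * l * l + l ^ 2 * 1 = l := by ring
  rw [e1]
  rwa [e2] at this

/-- A monotone sequence is bounded by its Poisson means at larger parameters. -/
lemma mul_le_of_hasSum_poissonWeight {a : ℕ → ℝ} (ha : Monotone a) (ha0 : ∀ n, 0 ≤ a n) {l p : ℝ}
    (hp : HasSum (fun n => poissonWeight l n * a n) p) {n : ℕ} (hl : (n : ℝ) < l) :
    a n * (1 - l / (l - n) ^ 2) ≤ p := by
  have hl0 : 0 ≤ l := le_trans (by positivity) hl.le
  have hd : 0 < l - n := by linarith
  have h := ((hasSum_poissonWeight l).sub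
    ((hasSum_variance_poissonWeight l).div_const ((l - n) ^ 2))).mul_left (a n)
  refine hasSum_le (fun k => ?_) h hp
  have hw := poissonWeight_nonneg hl0 k
  -- Chebyshev termwise: for k ≥ n monotonicity gives a k ≥ a n, and for k < n the factor
  -- (k-l)²/(l-n)² is at least 1, so the left term is nonpositive.
  rcases le_or_gt n k with hk | hk
  · have h1 := ha hk
    have h2 : 0 ≤ ((k : ℝ) - l) ^ 2 * poissonWeight l k / (l - n) ^ 2 := by positivity
    have h3 := ha0 n
    nlinarith
  · have h1 : (k : ℝ) < n := by exact_mod_cast hk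
    have h2 : poissonWeight l k ≤ ((k : ℝ) - l) ^ 2 * poissonWeight l k / (l - n) ^ 2 := by
      rw [le_div_iff₀ (by positivity), mul_comm]
      gcongr ?_ * _
      nlinarith
    have h3 := mul_nonneg hw (ha0 k)
    have h4 := ha0 n
    nlinarith

/-- A monotone sequence of linear growth is nearly bounded from below by its Poisson means at
smaller parameters. -/
lemma le_of_hasSum_poissonWeight {a : ℕ → ℝ} (ha : Monotone a) (ha0 : ∀ n, 0 ≤ a n) {l p C d : ℝ}
    (hp : HasSum (fun n => poissonWeight l n * a n) p) {n : ℕ} (hn : 0 < n) (hC : 0 ≤ C)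
    (haC : ∀ k, n < k → a k ≤ C * k) (hd : 0 < d) (hl0 : 0 ≤ l) (hl : l = (1 - d) * n) :
    p ≤ a n + C / d ^ 2 := by
  have hn' : (0:ℝ) < n := by exact_mod_cast hn
  have h := ((hasSum_poissonWeight l).mul_left (a n)).add
    ((hasSum_variance_poissonWeight l).mul_left (C / (d ^ 2 * n)))
  have hle : p ≤ a n * 1 + C / (d ^ 2 * n) * l := by
    refine hasSum_le (fun k => ?_) hp h
    have hw := poissonWeight_nonneg hl0 k
    rcases le_or_gt k n with hk | hk
    · have h1 := ha hk
      have h2 : 0 ≤ C / (d ^ 2 * n) * (((k : ℝ) - l) ^ 2 * poissonWeight l k) := by positivity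
      nlinarith
    · have h1 : (n : ℝ) < k := by exact_mod_cast hk
      have h2 : d * k ≤ k - l := by rw [hl]; nlinarith
      have h3 : d * n ≤ k - l := by nlinarith
      -- Both dn and dk are at most k - l, so the linear growth bound C·k is dominated by a multiple
      -- of (k-l)², which has a known Poisson mean.
      have h4 : d ^ 2 * n * k ≤ (k - l) ^ 2 := by
        have : (d * n) * (d * k) ≤ (k - l) * (k - l) := by gcongr; nlinarith
        nlinarith
      have h5 : a k ≤ C / (d ^ 2 * n) * (k - l) ^ 2 := by
        refine (haC k hk).trans ?_
        rw [div_mul_eq_mul_div, le_div_iff₀ (by positivity)]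
        nlinarith
      have h6 := mul_nonneg (ha0 n) hw
      nlinarith
  refine hle.trans ?_
  have : C / (d ^ 2 * n) * l ≤ C / d ^ 2 := by
    rw [hl, div_mul_eq_mul_div, div_le_div_iff₀ (by positivity) (by positivity)]
    have : 0 ≤ C * d ^ 2 * n := by positivity
    nlinarith
  linarith

open Filter in
/-- Depoissonization for monotone sequences. -/
lemma eventually_abs_div_sub_le {a : ℕ → ℝ} (ha : Monotone a) (ha0 : ∀ n, 0 ≤ a n) {p : ℝ → ℝ}
    {I E : ℝ} (hI : 0 ≤ I) (hE : 0 ≤ E)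
    (hp : ∀ᶠ l in atTop, HasSum (fun n => poissonWeight l n * a n) (p l))
    (hpE : ∀ δ > 0, ∀ᶠ l in atTop, |p l / l - I| ≤ E + δ) {δ : ℝ} (hδ : 0 < δ) :
    ∀ᶠ n : ℕ in atTop, |a n / n - I| ≤ E + δ := by
  set K := I + E + δ with hK
  have hK0 : 0 < K := by positivity
  set d := min (1 / 2) (δ / (4 * K)) with hd
  have hd0 : 0 < d := lt_min (by norm_num) (by positivity)
  have hd1 : d ≤ 1 / 2 := min_le_left _ _
  have hdK : d * K ≤ δ / 4 := by
    have : d ≤ δ / (4 * K) := min_le_right _ _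
    calc d * K ≤ δ / (4 * K) * K := by gcongr
      _ = δ / 4 := by field_simp
  have hcast : Tendsto (fun n : ℕ => (n : ℝ)) atTop atTop := tendsto_natCast_atTop_atTop
  have hup : Tendsto (fun n : ℕ => (1 + d) * (n : ℝ)) atTop atTop :=
    hcast.const_mul_atTop (by positivity)
  have hdown : Tendsto (fun n : ℕ => (1 - d) * (n : ℝ)) atTop atTop :=
    hcast.const_mul_atTop (by linarith)
  have hinv : ∀ c : ℝ, Tendsto (fun n : ℕ => c / (n : ℝ)) atTop (nhds 0) := fun c =>
    tendsto_const_nhds.div_atTop hcast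
  -- The parameter l = (1+d)n yields the upper half of the claim, and also the linear growth that
  -- the lower half at l = (1-d)n requires.
  have hupper : ∀ᶠ n : ℕ in atTop, a n ≤ K * n := by
    have hr : ∀ᶠ n : ℕ in atTop, (1 + d) / d ^ 2 / n < δ / (4 * K) :=
      (hinv _).eventually_lt_const (by positivity)
    filter_upwards [hup.eventually hp, hup.eventually (hpE (δ / 4) (by positivity)), hr,
      eventually_gt_atTop 0] with n h1 h2 h3 hn
    have hn' : (0:ℝ) < n := by exact_mod_cast hn
    have h4 := mul_le_of_hasSum_poissonWeight ha ha0 h1 (n := n) (by nlinarith)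
    have e : (1 + d) * n / ((1 + d) * n - n) ^ 2 = (1 + d) / d ^ 2 / n := by
      rw [show (1 + d) * (n:ℝ) - n = d * n by ring]; field_simp
    rw [e] at h4
    have h5 : p ((1 + d) * n) ≤ (I + E + δ / 4) * ((1 + d) * n) := by
      rw [abs_le] at h2
      rw [← div_le_iff₀ (by positivity)]; linarith
    have h6 : (I + E + δ / 4) * (1 + d) ≤ K - δ / 2 := by
      have : (I + E + δ / 4) * d ≤ K * d := by gcongr; linarith
      linarith
    have h7 : K * (1 - (1 + d) / d ^ 2 / n) ≥ K - δ / 4 := by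
      have : K * ((1 + d) / d ^ 2 / n) ≤ K * (δ / (4 * K)) := by gcongr
      have e2 : K * (δ / (4 * K)) = δ / 4 := by field_simp
      linarith
    by_contra hcon
    push Not at hcon
    set r := 1 - (1 + d) / d ^ 2 / (n : ℝ) with hr
    have hK4 : δ / 4 ≤ K := by rw [hK]; linarith
    have hr0 : 0 ≤ r := by
      by_contra hneg
      push Not at hneg
      nlinarith
    have h8 : K * n * r ≤ a n * r := by gcongr
    nlinarith
  obtain ⟨N, hN⟩ := eventually_atTop.1 hupper
  have hr : ∀ᶠ n : ℕ in atTop, K / d ^ 2 / n < δ / 4 := (hinv _).eventually_lt_const (by positivity)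
  filter_upwards [hdown.eventually hp, hdown.eventually (hpE (δ / 4) (by positivity)), hr,
    eventually_gt_atTop 0, eventually_ge_atTop N] with n h1 h2 h3 hn hnN
  have hn' : (0:ℝ) < n := by exact_mod_cast hn
  have h1d : 0 < 1 - d := by linarith
  have h4 := le_of_hasSum_poissonWeight ha ha0 h1 hn hK0.le (fun k hk => hN k (by omega)) hd0
    (by positivity) rfl
  have h5 : (I - E - δ / 4) * ((1 - d) * n) ≤ p ((1 - d) * n) := by
    rw [abs_le] at h2
    rw [← le_div_iff₀ (by positivity)]; linarith
  have h6 : I - E - δ / 2 ≤ (I - E - δ / 4) * (1 - d) := by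
    have : (I - E - δ / 4) * d ≤ K * d := by gcongr; linarith
    linarith
  have h7 : K / d ^ 2 ≤ δ / 4 * n := by
    rw [← div_le_iff₀ hn']; exact h3.le
  rw [abs_le, le_sub_iff_add_le, sub_le_iff_le_add, le_div_iff₀ hn', div_le_iff₀ hn']
  constructor
  · nlinarith
  · have := hN n hnN
    linarith

/-! ### Cell contents as a function of the set of received values -/

/-- The content `c` of a cell that has received the set `S` of values. -/
def CellInv (S : ℕ → Prop) (c : ℕ × Bool) : Prop :=
  (c.1 = 0 ∨ S c.1) ∧ (∀ r, S r → r ≤ c.1) ∧ (c.2 = true ↔ c.1 ≤ 1 ∨ S (c.1 - 1))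

/-- The set determines the cell: the counter is its maximum (0 if empty), and the bit tells whether
the preceding value occurs. Order and repetitions in the stream therefore do not matter. -/
lemma CellInv.unique {S : ℕ → Prop} {c c' : ℕ × Bool} (h : CellInv S c) (h' : CellInv S c') :
    c = c' := by
  obtain ⟨k, b⟩ := c
  obtain ⟨k', b'⟩ := c'
  obtain ⟨h1, h2, h3⟩ := h
  obtain ⟨h1', h2', h3'⟩ := h'
  simp only at *
  have hk : k = k' := by
    rcases h1 with h1 | h1 <;> rcases h1' with h1' | h1'
    · omega
    · have := h2 _ h1'; omega
    · have := h2' _ h1; omega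
    · have := h2 _ h1'; have := h2' _ h1; omega
  subst hk
  rw [Prod.mk.injEq]
  exact ⟨rfl, Bool.eq_iff_iff.2 (h3.trans h3'.symm)⟩

lemma CellInv.update {S : ℕ → Prop} {c : ℕ × Bool} (h : CellInv S c) (r : ℕ) :
    CellInv (fun k => S k ∨ k = r) (cellUpdate c r) := by
  obtain ⟨k, b⟩ := c
  obtain ⟨h1, h2, h3⟩ := h
  simp only at h1 h2 h3
  unfold cellUpdate CellInv
  simp only
  split_ifs with a1 a2 a3
  · refine ⟨Or.inr (Or.inr rfl), ?_, ?_⟩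
    · rintro q (hq | rfl)
      · have := h2 q hq; simp only; omega
      · exact le_rfl
    · simp only [true_iff]
      subst a1
      rcases h1 with h1 | h1
      · left; omega
      · right; left; simpa using h1
  · refine ⟨Or.inr (Or.inr rfl), ?_, ?_⟩
    · rintro q (hq | rfl)
      · have := h2 q hq; simp only; omega
      · exact le_rfl
    · simp only [false_iff]
      rintro (h | h | h)
      · omega
      · have := h2 _ h; omega
      · omega
  · obtain ⟨a3, rfl⟩ := a3
    refine ⟨h1.imp id Or.inl, ?_, ?_⟩
    · rintro q (hq | rfl)
      · exact h2 q hq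
      · simp only; omega
    · simp only [true_iff]
      right; right; omega
  · refine ⟨h1.imp id Or.inl, ?_, ?_⟩
    · rintro q (hq | rfl)
      · exact h2 q hq
      · simp only; omega
    · simp only
      rw [h3]
      constructor
      · exact fun h => h.imp id Or.inl
      · rintro (h | h | h)
        · exact Or.inl h
        · exact Or.inr h
        · by_cases hk : k ≤ 1
          · exact Or.inl hk
          -- If the value just below the counter arrives and nothing changes, the bit was already
          -- set.
          · have hb : b = true := by
              by_contra hb
              exact a3 ⟨by omega, by simpa using hb⟩
            exact h3.1 hb

lemma run_append_singleton {m : ℕ} {V : Type*} (h : V → Fin m × ℕ) (M : List V) (v : V) :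
    run h (M ++ [v]) = insert (run h M) (h v) := by
  simp [run, List.foldl_append]

lemma cellInv_run {m : ℕ} {V : Type*} (h : V → Fin m × ℕ) (M : List V) (j : Fin m) :
    CellInv (fun r => ∃ v ∈ M, h v = (j, r)) (run h M j) := by
  induction M using List.reverseRecOn with
  | nil => simp [run, initial, CellInv]
  | append_singleton M v ih =>
    rw [run_append_singleton, insert]
    rcases eq_or_ne j (h v).1 with hj | hj
    · subst hj
      rw [Function.update_self]
      convert ih.update (h v).2 using 2 with r
      simp only [List.mem_append, List.mem_singleton, or_and_right, exists_or, exists_eq_left]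
      rw [Prod.ext_iff (x := h v)]
      simp [eq_comm]
    · rw [Function.update_of_ne hj]
      convert ih using 2 with r
      simp only [List.mem_append, List.mem_singleton, or_and_right, exists_or, exists_eq_left]
      rw [Prod.ext_iff (x := h v)]
      simp [hj.symm]

lemma run_eq_iff {m : ℕ} {V : Type*} (h : V → Fin m × ℕ) (M : List V) (s : Sketch m) :
    run h M = s ↔ ∀ j, CellInv (fun r => ∃ v ∈ M, h v = (j, r)) (s j) := by
  constructor
  · rintro rfl j
    exact cellInv_run h M j
  · intro hs
    ext1 j
    exact (cellInv_run h M j).unique (hs j)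

/-- The sets of values whose avoidance describes the cell content `c`. -/
def avoidSet (c : ℕ × Bool) (i : Bool × Bool) : Set ℕ :=
  {r | c.1 < r ∨ (i.1 = true ∧ r = c.1 ∧ c.1 ≠ 0) ∨ (i.2 = true ∧ r + 1 = c.1 ∧ 2 ≤ c.1)}

/-- The coefficients of the inclusion-exclusion formula for the cell content `c`. -/
noncomputable def avoidCoeff (c : ℕ × Bool) (i : Bool × Bool) : ℝ :=
  (if i.1 then -(if c.1 = 0 then 0 else 1) else 1) *
    (if i.2 then (if c.2 then -1 else 1) * (if c.1 ≤ 1 then 0 else 1) else (if c.2 then 1 else 0))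

/-- The probability that a value lies in `avoidSet c i`. -/
noncomputable def avoidMass (c : ℕ × Bool) (i : Bool × Bool) : ℝ :=
  2 ^ (-(c.1 : ℤ)) + (if i.1 ∧ c.1 ≠ 0 then 2 ^ (-(c.1 : ℤ)) else 0)
    + (if i.2 ∧ 2 ≤ c.1 then 2 ^ (-(c.1 : ℤ) + 1) else 0)

lemma cellLaw_eq_sum (x : ℝ) (c : ℕ × Bool) :
    cellLaw x c = ∑ i, avoidCoeff c i * Real.exp (-(x * avoidMass c i)) := by
  obtain ⟨k, b⟩ := c
  have h1 : ∀ a b : ℝ, Real.exp (-(x * (a + b))) = Real.exp (-(x * a)) * Real.exp (-(x * b)) :=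
    fun a b => by rw [← Real.exp_add]; ring_nf
  rw [Fintype.sum_prod_type]
  simp only [Fintype.sum_bool, cellLaw, avoidCoeff, avoidMass, h1]
  rcases Nat.lt_or_ge k 2 with hk | hk
  · interval_cases k <;> cases b <;> simp <;> ring
  · have h2 : k ≠ 0 := by omega
    have h3 : ¬ k ≤ 1 := by omega
    cases b <;> simp [h2, h3, hk] <;> ring

-- Presence is one minus absence, both for the maximum k and for k - 1, so inclusion-exclusion
-- leaves only avoidance events. These are the events whose probabilities multiply over independent
-- elements.
open Classical in
lemma ite_cellInv_eq_sum (S : ℕ → Prop) (c : ℕ × Bool) :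
    (if CellInv S c then (1:ℝ) else 0)
      = ∑ i, avoidCoeff c i * (if ∀ r ∈ avoidSet c i, ¬ S r then 1 else 0) := by
  obtain ⟨k, b⟩ := c
  have hA : ∀ i, (∀ r ∈ avoidSet (k, b) i, ¬ S r) ↔ (∀ r, k < r → ¬ S r) ∧
      (i.1 = true → k ≠ 0 → ¬ S k) ∧ (i.2 = true → 2 ≤ k → ¬ S (k - 1)) := by
    intro i
    constructor
    · intro h
      refine ⟨fun r hr => h r (Or.inl hr), fun h1 h2 => h k (Or.inr (Or.inl ⟨h1, rfl, h2⟩)),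
        fun h1 h2 => h (k - 1) (Or.inr (Or.inr ⟨h1, by simp only; omega, h2⟩))⟩
    · rintro ⟨h1, h2, h3⟩ r (hr | ⟨a, rfl, b⟩ | ⟨a, b, c⟩)
      · exact h1 r hr
      · exact h2 a b
      · have : r = k - 1 := by simp only at b; omega
        rw [this]; exact h3 a c
  have hI : CellInv S (k, b) ↔ (k = 0 ∨ S k) ∧ (∀ r, k < r → ¬ S r) ∧ (b = true ↔ k ≤ 1 ∨ S (k - 1)) := by
    unfold CellInv
    refine and_congr_right fun _ => and_congr_left fun _ => ?_
    exact forall_congr' fun r => ⟨fun h hr hs => by have := h hs; omega,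
      fun h hs => by by_contra hc; exact h (not_le.1 hc) hs⟩
  simp only [hA, hI]
  rw [Fintype.sum_prod_type]
  simp only [Fintype.sum_bool, avoidCoeff]
  clear hA hI
  generalize (∀ r, k < r → ¬ S r) = Q
  by_cases h0 : Q
  · rcases Nat.lt_or_ge k 2 with hk | hk
    · interval_cases k
      · cases b <;> simp [h0]
      · by_cases h1 : S 1 <;> cases b <;> simp [h0, h1]
    · have h2 : k ≠ 0 := by omega
      have h3 : ¬ k ≤ 1 := by omega
      by_cases h4 : S k <;> by_cases h5 : S (k - 1) <;> cases b <;> simp [h0, h2, h3, h4, h5, hk]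
  · simp [h0]

/-- The hash values whose avoidance is required by the choice `I` of one term per cell. -/
def avoidHash {m : ℕ} (s : Sketch m) (I : Fin m → Bool × Bool) : Set (Fin m × ℕ) :=
  {x | x.2 ∈ avoidSet (s x.1) (I x.1)}

open Classical in
lemma ite_run_eq_sum {m : ℕ} {V : Type*} (h : V → Fin m × ℕ) (M : List V) (s : Sketch m) :
    (if run h M = s then (1:ℝ) else 0)
      = ∑ I : Fin m → Bool × Bool, (∏ j, avoidCoeff (s j) (I j)) *
        (if ∀ v ∈ M, h v ∉ avoidHash s I then 1 else 0) := by
  have e1 : (if run h M = s then (1:ℝ) else 0)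
      = ∏ j, (if CellInv (fun r => ∃ v ∈ M, h v = (j, r)) (s j) then (1:ℝ) else 0) := by
    rw [Finset.prod_ite_zero]
    simp [run_eq_iff]
  rw [e1]
  simp only [ite_cellInv_eq_sum]
  rw [Finset.prod_univ_sum]
  simp only [Fintype.piFinset_univ, Finset.prod_mul_distrib]
  refine Finset.sum_congr rfl fun I _ => ?_
  congr 1
  rw [Finset.prod_ite_zero]
  simp only [Finset.prod_const_one, Finset.mem_univ, true_implies]
  congr 1
  rw [eq_iff_iff]
  constructor
  · intro H v hv hm
    exact H (h v).1 _ hm ⟨v, hv, rfl⟩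
  · rintro H j r hr ⟨v, hv, e⟩
    refine H v hv ?_
    rw [avoidHash, Set.mem_ofPred_eq, e]
    exact hr

/-! ### The law of the sketch after n distinct elements -/

lemma hasSum_indicator_Ioi (k : ℕ) :
    HasSum ((Set.Ioi k).indicator fun r : ℕ => (1 / 2 : ℝ) ^ r) (2 ^ (-(k : ℤ))) := by
  rw [← hasSum_nat_add_iff' (k + 1)]
  have h0 : ∑ i ∈ Finset.range (k + 1), (Set.Ioi k).indicator (fun r : ℕ => (1 / 2 : ℝ) ^ r) i = 0 :=
    Finset.sum_eq_zero fun i hi => Set.indicator_of_notMem (by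
      have := Finset.mem_range.1 hi
      simp only [Set.mem_Ioi]; omega) _
  have h1 : ∀ n : ℕ, (Set.Ioi k).indicator (fun r : ℕ => (1 / 2 : ℝ) ^ r) (n + (k + 1))
      = (1 / 2) ^ (k + 1) * (1 / 2) ^ n := fun n => by
    rw [Set.indicator_of_mem (by simp only [Set.mem_Ioi]; omega), ← pow_add, add_comm]
  simp only [h0, h1, sub_zero]
  have := hasSum_geometric_two.mul_left ((1 / 2 : ℝ) ^ (k + 1))
  have e : (2:ℝ) ^ (-(k : ℤ)) = (1 / 2) ^ (k + 1) * 2 := by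
    rw [zpow_neg, zpow_natCast, pow_succ, one_div, inv_pow]; ring
  rwa [e]

lemma hasSum_indicator_avoidSet (c : ℕ × Bool) (i : Bool × Bool) :
    HasSum ((avoidSet c i).indicator fun r : ℕ => (1 / 2 : ℝ) ^ r) (avoidMass c i) := by
  obtain ⟨k, b⟩ := c
  have h1 := hasSum_indicator_Ioi k
  have h2 : HasSum (fun r : ℕ => if r = k then (if i.1 ∧ k ≠ 0 then (2:ℝ) ^ (-(k : ℤ)) else 0) else 0)
      (if i.1 ∧ k ≠ 0 then (2:ℝ) ^ (-(k : ℤ)) else 0) := hasSum_ite_eq _ _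
  have h3 : HasSum (fun r : ℕ => if r = k - 1 then (if i.2 ∧ 2 ≤ k then (2:ℝ) ^ (-(k : ℤ) + 1) else 0) else 0)
      (if i.2 ∧ 2 ≤ k then (2:ℝ) ^ (-(k : ℤ) + 1) else 0) := hasSum_ite_eq _ _
  have h := (h1.add h2).add h3
  have e : ∀ r : ℕ, (avoidSet (k, b) i).indicator (fun r : ℕ => (1 / 2 : ℝ) ^ r) r
      = (Set.Ioi k).indicator (fun r : ℕ => (1 / 2 : ℝ) ^ r) r
      + (if r = k then (if i.1 ∧ k ≠ 0 then (2:ℝ) ^ (-(k : ℤ)) else 0) else 0)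
      + (if r = k - 1 then (if i.2 ∧ 2 ≤ k then (2:ℝ) ^ (-(k : ℤ) + 1) else 0) else 0) := fun r => by
    have hz : ∀ q : ℕ, (1 / 2 : ℝ) ^ q = 2 ^ (-(q : ℤ)) := fun q => by
      rw [zpow_neg, zpow_natCast, one_div, inv_pow]
    rcases lt_trichotomy k r with hr | rfl | hr
    · rw [Set.indicator_of_mem (show r ∈ avoidSet (k, b) i from Or.inl hr),
        Set.indicator_of_mem (show r ∈ Set.Ioi k from hr), if_neg (by omega), if_neg (by omega)]
      ring
    · rw [Set.indicator_of_notMem (s := Set.Ioi k) (by simp), if_pos rfl, zero_add]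
      have h3 : (if k = k - 1 then (if i.2 ∧ 2 ≤ k then (2:ℝ) ^ (-(k : ℤ) + 1) else 0) else 0) = 0 := by
        split_ifs <;> first | rfl | omega
      rw [h3, add_zero]
      by_cases hi : i.1 = true ∧ k ≠ 0
      · rw [if_pos hi, Set.indicator_of_mem (show k ∈ avoidSet (k, b) i from Or.inr (Or.inl ⟨hi.1, rfl, hi.2⟩)), hz]
      · rw [if_neg hi, Set.indicator_of_notMem]
        rintro (h | ⟨h1, -, h2⟩ | ⟨-, h, -⟩)
        · simp at h
        · exact hi ⟨h1, h2⟩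
        · simp at h
    · rw [Set.indicator_of_notMem (s := Set.Ioi k) (by simp [hr.le]), if_neg (by omega), zero_add, zero_add]
      by_cases hr1 : r = k - 1
      · rw [if_pos hr1]
        by_cases hi : i.2 = true ∧ 2 ≤ k
        · rw [if_pos hi, Set.indicator_of_mem (show r ∈ avoidSet (k, b) i from
            Or.inr (Or.inr ⟨hi.1, by simp only; omega, hi.2⟩)), hz]
          congr 1
          omega
        · rw [if_neg hi, Set.indicator_of_notMem]
          rintro (h | ⟨-, h, -⟩ | ⟨h1, -, h2⟩)
          · simp only at h; omega
          · simp only at h; omega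
          · exact hi ⟨h1, h2⟩
      · rw [if_neg hr1, Set.indicator_of_notMem]
        rintro (h | ⟨-, h, -⟩ | ⟨h1, h, h2⟩) <;> simp only at h <;> omega
  simp only [← e] at h
  exact h

/-- The law of a hash value is prescribed only for values at least 1, so the value 0 must not enter
any computed mass. -/
lemma zero_notMem_avoidSet (c : ℕ × Bool) (i : Bool × Bool) : 0 ∉ avoidSet c i := by
  rintro (h | ⟨-, h, h'⟩ | ⟨-, h, h'⟩)
  · simp at h
  · exact h' h.symm
  · omega

lemma IsRandomHash.measureReal_avoidHash {m : ℕ} {V Ω : Type*} [MeasurableSpace Ω] {P : Measure Ω}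
    [IsProbabilityMeasure P] {h : V → Ω → Fin m × ℕ} (hh : IsRandomHash P h) (v : V) (s : Sketch m)
    (I : Fin m → Bool × Bool) :
    P.real {ω | h v ω ∈ avoidHash s I} = 1 / (m : ℝ) * ∑ j, avoidMass (s j) (I j) := by
  have hm := hh.measurable v
  have e0 : P {ω | h v ω ∈ avoidHash s I} = (P.map (h v)) (avoidHash s I) := by
    rw [Measure.map_apply hm (Set.to_countable _).measurableSet]; rfl
  have e1 : ∀ j r, (avoidHash s I).indicator (fun x => (P.map (h v)) {x}) (j, r)
      = ENNReal.ofReal (1 / (m:ℝ) * (avoidSet (s j) (I j)).indicator (fun r : ℕ => (1 / 2 : ℝ) ^ r) r) := by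
    intro j r
    by_cases hr : r ∈ avoidSet (s j) (I j)
    · rw [Set.indicator_of_mem hr, Set.indicator_of_mem (show (j, r) ∈ avoidHash s I from hr),
        Measure.map_apply hm (measurableSet_singleton _), ← hh.law v j r, ofReal_measureReal]
      · rfl
      · rcases Nat.eq_zero_or_pos r with rfl | h0
        · exact absurd hr (zero_notMem_avoidSet _ _)
        · exact h0
    · rw [Set.indicator_of_notMem hr, Set.indicator_of_notMem (show (j, r) ∉ avoidHash s I from hr)]
      simp
  have e2 : ∀ j, ∑' r, ENNReal.ofReal (1 / (m:ℝ) * (avoidSet (s j) (I j)).indicator (fun r : ℕ => (1 / 2 : ℝ) ^ r) r)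
      = ENNReal.ofReal (1 / (m:ℝ) * avoidMass (s j) (I j)) := fun j => by
    have := (hasSum_indicator_avoidSet (s j) (I j)).mul_left (1 / (m:ℝ))
    rw [← this.tsum_eq, ENNReal.ofReal_tsum_of_nonneg _ this.summable]
    intro r
    exact mul_nonneg (by positivity) (Set.indicator_nonneg (fun r _ => by positivity) r)
  have hmass : ∀ j, 0 ≤ 1 / (m:ℝ) * avoidMass (s j) (I j) := fun j => by
    rw [avoidMass]; positivity
  rw [measureReal_def, e0, ← Measure.tsum_indicator_apply_singleton _ _ (Set.to_countable _).measurableSet,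
    ENNReal.tsum_prod']
  simp only [e1, e2]
  rw [tsum_fintype, ← ENNReal.ofReal_sum_of_nonneg (fun j _ => hmass j),
    ENNReal.toReal_ofReal (Finset.sum_nonneg fun j _ => hmass j), Finset.mul_sum]

/-- The probability of the sketch `s` after `n` distinct elements. -/
noncomputable def sketchLaw {m : ℕ} (n : ℕ) (s : Sketch m) : ℝ :=
  ∑ I : Fin m → Bool × Bool, (∏ j, avoidCoeff (s j) (I j)) *
    (1 - 1 / (m : ℝ) * ∑ j, avoidMass (s j) (I j)) ^ n

lemma measurable_run {m : ℕ} {V Ω : Type*} [MeasurableSpace Ω] {h : V → Ω → Fin m × ℕ}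
    (hh : ∀ v, Measurable (h v)) (M : List V) : Measurable fun ω => run (h · ω) M := by
  induction M using List.reverseRecOn with
  | nil => exact measurable_const
  | append_singleton M v ih =>
    simp only [run_append_singleton]
    exact (Measurable.of_discrete (f := fun p : Sketch m × (Fin m × ℕ) => insert p.1 p.2)).comp
      (ih.prodMk (hh v))

lemma IsRandomHash.measureReal_avoid {m : ℕ} {V Ω : Type*} [DecidableEq V] [MeasurableSpace Ω] {P : Measure Ω}
    [IsProbabilityMeasure P] {h : V → Ω → Fin m × ℕ} (hh : IsRandomHash P h) (M : List V) (s : Sketch m)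
    (I : Fin m → Bool × Bool) :
    P.real {ω | ∀ v ∈ M, h v ω ∉ avoidHash s I}
      = (1 - 1 / (m : ℝ) * ∑ j, avoidMass (s j) (I j)) ^ M.toFinset.card := by
  have e : {ω | ∀ v ∈ M, h v ω ∉ avoidHash s I} = ⋂ v ∈ M.toFinset, h v ⁻¹' (avoidHash s I)ᶜ := by
    ext ω; simp
  have hU : MeasurableSet (avoidHash s I) := (Set.to_countable _).measurableSet
  rw [e, measureReal_def, hh.indep.measure_inter_preimage_eq_mul M.toFinset (sets := fun _ => (avoidHash s I)ᶜ)
    (fun _ _ => hU.compl), ENNReal.toReal_prod, ← Finset.prod_const]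
  refine Finset.prod_congr rfl fun v _ => ?_
  rw [Set.preimage_compl, ← measureReal_def, probReal_compl_eq_one_sub (hh.measurable v hU)]
  congr 1
  exact hh.measureReal_avoidHash v s I

lemma IsRandomHash.measureReal_run {m : ℕ} {V Ω : Type*} [DecidableEq V] [MeasurableSpace Ω] {P : Measure Ω}
    [IsProbabilityMeasure P] {h : V → Ω → Fin m × ℕ} (hh : IsRandomHash P h) (M : List V) (s : Sketch m) :
    P.real {ω | run (h · ω) M = s} = sketchLaw M.toFinset.card s := by
  classical
  have hm1 : MeasurableSet {ω | run (h · ω) M = s} := measurable_run hh.measurable M (measurableSet_singleton s)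
  have hm2 : ∀ I, MeasurableSet {ω | ∀ v ∈ M, h v ω ∉ avoidHash s I} := fun I => by
    have e : {ω | ∀ v ∈ M, h v ω ∉ avoidHash s I} = ⋂ v ∈ M.toFinset, h v ⁻¹' (avoidHash s I)ᶜ := by
      ext ω; simp
    rw [e]
    exact Finset.measurableSet_biInter _ fun v _ =>
      hh.measurable v (Set.to_countable _).measurableSet.compl
  have key : {ω | run (h · ω) M = s}.indicator (1 : Ω → ℝ)
      = fun ω => ∑ I : Fin m → Bool × Bool, (∏ j, avoidCoeff (s j) (I j)) *
        {ω | ∀ v ∈ M, h v ω ∉ avoidHash s I}.indicator (1 : Ω → ℝ) ω := by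
    ext ω
    simp only [Set.indicator_apply, Pi.one_apply]
    convert ite_run_eq_sum (h · ω) M s <;> exact Iff.rfl
  rw [← integral_indicator_one hm1, key, integral_finsetSum]
  · refine Finset.sum_congr rfl fun I _ => ?_
    rw [integral_const_mul, ← hh.measureReal_avoid M s I, ← integral_indicator_one (hm2 I)]
  · exact fun I _ => ((integrable_const 1).indicator (hm2 I)).const_mul _

/-! ### Monotonicity of the indicator and of its mean -/

lemma indicator_eq {m : ℕ} (s : Sketch m) : indicator s = (∑ j, cellValue (s j))⁻¹ := rfl

lemma cellValue_pos (c : ℕ × Bool) : 0 < cellValue c := by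
  obtain ⟨k, b⟩ := c
  cases b <;> simp [cellValue] <;> positivity

lemma sum_cellValue_pos {m : ℕ} (hm : 0 < m) (s : Sketch m) : 0 < ∑ j, cellValue (s j) :=
  Finset.sum_pos (fun _ _ => cellValue_pos _) ⟨⟨0, hm⟩, Finset.mem_univ _⟩

lemma cellValue_cellUpdate_le (c : ℕ × Bool) (r : ℕ) : cellValue (cellUpdate c r) ≤ cellValue c := by
  obtain ⟨k, b⟩ := c
  have hz : ∀ k : ℕ, (2:ℝ) ^ (-(k : ℤ) + 1) = 2 * 2 ^ (-(k : ℤ)) := fun k => by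
    rw [zpow_add_one₀ two_ne_zero, mul_comm]
  have hb : (0:ℝ) ≤ 1 - (b.toNat : ℝ) := by cases b <;> simp
  have hk : (0:ℝ) < 2 ^ (-(k : ℤ)) := by positivity
  have hle : (2:ℝ) ^ (-(k : ℤ)) ≤ cellValue (k, b) := by
    simp only [cellValue]
    have : (0:ℝ) ≤ (1 - (b.toNat : ℝ)) * 2 ^ (-(k : ℤ) + 1) := mul_nonneg hb (by positivity)
    linarith
  unfold cellUpdate
  simp only
  split_ifs with h1 h2 h3
  · refine le_trans ?_ hle
    subst h1
    simp only [cellValue, Bool.toNat_true, Nat.cast_one, sub_self, zero_mul, add_zero]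
    exact zpow_le_zpow_right₀ one_le_two (by push_cast; omega)
  · refine le_trans ?_ hle
    simp only [cellValue, Bool.toNat_false, Nat.cast_zero, sub_zero, one_mul, hz]
    -- A jump by at least 2 clears the bit, and the new value 3·2^{-r} is at most (3/4)·2^{-k}.
    have : (2:ℝ) ^ (-(r : ℤ)) ≤ 2 ^ (-(k : ℤ) - 2) := zpow_le_zpow_right₀ one_le_two (by omega)
    rw [zpow_sub₀ two_ne_zero] at this
    have e : (2:ℝ) ^ (2:ℤ) = 4 := by norm_num
    rw [e] at this
    linarith
  · rw [h3.2]
    simp only [cellValue, Bool.toNat_true, Bool.toNat_false, Nat.cast_one, Nat.cast_zero, sub_self,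
      sub_zero, zero_mul, one_mul, add_zero]
    have : (0:ℝ) < 2 ^ (-(k : ℤ) + 1) := by positivity
    linarith
  · exact le_rfl

lemma indicator_le_insert {m : ℕ} (hm : 0 < m) (s : Sketch m) (x : Fin m × ℕ) :
    indicator s ≤ indicator (insert s x) := by
  rw [indicator_eq, indicator_eq]
  refine inv_anti₀ (sum_cellValue_pos hm _) (Finset.sum_le_sum fun j _ => ?_)
  rw [insert]
  rcases eq_or_ne j x.1 with rfl | hj
  · rw [Function.update_self]; exact cellValue_cellUpdate_le _ _
  · rw [Function.update_of_ne hj]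

lemma indicator_nonneg {m : ℕ} (s : Sketch m) : 0 ≤ indicator s :=
  inv_nonneg.2 (Finset.sum_nonneg fun _ _ => (cellValue_pos _).le)

/-- The expectation of `indicator` after `n` distinct elements. -/
noncomputable def meanIndicator (m n : ℕ) : ENNReal :=
  ∑' s : Sketch m, ENNReal.ofReal (indicator s) * ENNReal.ofReal (sketchLaw n s)

lemma IsRandomHash.lintegral_indicator_run {m : ℕ} {V Ω : Type*} [DecidableEq V] [MeasurableSpace Ω]
    {P : Measure Ω} [IsProbabilityMeasure P] {h : V → Ω → Fin m × ℕ} (hh : IsRandomHash P h)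
    (M : List V) :
    ∫⁻ ω, ENNReal.ofReal (indicator (run (h · ω) M)) ∂P = meanIndicator m M.toFinset.card := by
  have hm := measurable_run hh.measurable M
  rw [← lintegral_map (f := fun s : Sketch m => ENNReal.ofReal (indicator s)) Measurable.of_discrete hm,
    lintegral_countable', meanIndicator]
  congr 1 with s
  rw [Measure.map_apply hm (measurableSet_singleton s), ← hh.measureReal_run M s, ofReal_measureReal]
  rfl

-- A concrete model lets `sketchLaw_nonneg` and `monotone_meanIndicator` be read off from
-- probabilities, although the formula for `sketchLaw` has alternating signs.
open ProbabilityTheory in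
lemma exists_isRandomHash {m : ℕ} (hm : 0 < m) :
    ∃ (Ω : Type) (_ : MeasurableSpace Ω) (P : Measure Ω) (h : ℕ → Ω → Fin m × ℕ),
      IsProbabilityMeasure P ∧ IsRandomHash P h := by
  have hm0 : (m : ℝ) ≠ 0 := by positivity
  let w : Fin m × ℕ → ENNReal := fun x => ENNReal.ofReal (1 / (m:ℝ) * (Set.Ioi 0).indicator (fun r : ℕ => (1 / 2 : ℝ) ^ r) x.2)
  have hw : ∑' x, w x = 1 := by
    have h1 := (hasSum_indicator_Ioi 0).mul_left (1 / (m:ℝ))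
    have h2 : ∀ r : ℕ, 0 ≤ 1 / (m:ℝ) * (Set.Ioi 0).indicator (fun r : ℕ => (1 / 2 : ℝ) ^ r) r := fun r =>
      mul_nonneg (by positivity) (Set.indicator_nonneg (fun r _ => by positivity) r)
    rw [ENNReal.tsum_prod']
    simp only [w]
    rw [tsum_fintype, ← ENNReal.ofReal_tsum_of_nonneg h2 h1.summable, h1.tsum_eq, Finset.sum_const,
      Finset.card_univ, Fintype.card_fin, nsmul_eq_mul, ← ENNReal.ofReal_natCast, ← ENNReal.ofReal_mul (by positivity)]
    simp [hm0]
  let p : PMF (Fin m × ℕ) := ⟨w, hw ▸ ENNReal.summable.hasSum⟩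
  obtain ⟨Ω, mΩ, P, X, hX, hL, hI, hP⟩ := exists_iid ℕ p.toMeasure
  refine ⟨Ω, mΩ, P, X, hP, hX, hI, fun v j k hk => ?_⟩
  have : P {ω | X v ω = (j, k)} = w (j, k) := by
    have h1 : P (X v ⁻¹' {(j, k)}) = p.toMeasure {(j, k)} := by
      rw [← (hL v).map_eq, Measure.map_apply (hX v) (measurableSet_singleton _)]
    rw [p.toMeasure_apply_singleton _ (measurableSet_singleton _)] at h1
    exact h1
  rw [measureReal_def, this]
  simp only [w]
  rw [Set.indicator_of_mem (show k ∈ Set.Ioi 0 from hk), ENNReal.toReal_ofReal (by positivity)]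

lemma sketchLaw_nonneg {m : ℕ} (hm : 0 < m) (n : ℕ) (s : Sketch m) : 0 ≤ sketchLaw n s := by
  obtain ⟨Ω, _, P, h, hP, hh⟩ := exists_isRandomHash hm
  have := hh.measureReal_run (List.range n) s
  rw [List.toFinset_range, Finset.card_range] at this
  rw [← this]; positivity

lemma monotone_meanIndicator {m : ℕ} (hm : 0 < m) : Monotone (meanIndicator m) := by
  obtain ⟨Ω, _, P, h, hP, hh⟩ := exists_isRandomHash hm
  have e : ∀ n, meanIndicator m n = ∫⁻ ω, ENNReal.ofReal (indicator (run (h · ω) (List.range n))) ∂P := fun n => by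
    rw [hh.lintegral_indicator_run, List.toFinset_range, Finset.card_range]
  refine monotone_nat_of_le_succ fun n => ?_
  rw [e, e]
  refine lintegral_mono fun ω => ENNReal.ofReal_le_ofReal ?_
  rw [List.range_succ, run_append_singleton]
  exact indicator_le_insert hm _ _

/-! ### Poissonization -/

/-- Poisson averaging turns the n-th power of one minus a mass into an exponential of that mass. The
mass is a sum over cells, so each term of the inclusion-exclusion sum, and then the whole sum,
factors over cells. -/
lemma hasSum_poissonWeight_mul_sketchLaw {m : ℕ} (hm : 0 < m) (x : ℝ) (s : Sketch m) :
    HasSum (fun n => poissonWeight (m * x) n * sketchLaw n s) (∏ j, cellLaw x (s j)) := by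
  have hm0 : (m : ℝ) ≠ 0 := by positivity
  have h : ∀ I ∈ (Finset.univ : Finset (Fin m → Bool × Bool)), HasSum (fun n => (∏ j, avoidCoeff (s j) (I j)) *
      (poissonWeight (m * x) n * (1 - 1 / (m : ℝ) * ∑ j, avoidMass (s j) (I j)) ^ n))
      ((∏ j, avoidCoeff (s j) (I j)) * Real.exp (-(m * x * (1 - (1 - 1 / (m : ℝ) * ∑ j, avoidMass (s j) (I j)))))) :=
    fun I _ => (hasSum_poissonWeight_mul_pow _ _).mul_left _
  have h2 := hasSum_sum h
  have e1 : ∏ j, cellLaw x (s j) = ∑ I : Fin m → Bool × Bool, (∏ j, avoidCoeff (s j) (I j)) *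
      Real.exp (-(m * x * (1 - (1 - 1 / (m : ℝ) * ∑ j, avoidMass (s j) (I j))))) := by
    simp only [cellLaw_eq_sum]
    rw [Finset.prod_univ_sum, Fintype.piFinset_univ]
    refine Finset.sum_congr rfl fun I _ => ?_
    rw [Finset.prod_mul_distrib, ← Real.exp_sum, Finset.sum_neg_distrib, ← Finset.mul_sum]
    congr 3
    field_simp
    ring
  rw [e1]
  convert h2 using 2 with n
  rw [sketchLaw, Finset.mul_sum]
  exact Finset.sum_congr rfl fun I _ => by ring

lemma tsum_pi_prod {α : Type*} (g : α → ENNReal) (m : ℕ) :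
    ∑' s : Fin m → α, ∏ j, g (s j) = (∑' c, g c) ^ m := by
  induction m with
  | zero => simp
  | succ m ih =>
    rw [← (Fin.consEquiv fun _ : Fin (m + 1) => α).tsum_eq, ENNReal.tsum_prod']
    simp only [Fin.consEquiv_apply, Fin.prod_univ_succ, Fin.cons_zero, Fin.cons_succ]
    simp only [ENNReal.tsum_mul_left, ih, ENNReal.tsum_mul_right]
    rw [pow_succ, mul_comm]

lemma ofReal_inv_eq_lintegral {a : ℝ} (ha : 0 < a) :
    ENNReal.ofReal a⁻¹ = ∫⁻ t in Set.Ioi (0:ℝ), ENNReal.ofReal (Real.exp (-(t * a))) := by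
  have h1 := integral_exp_mul_Ioi (neg_lt_zero.2 ha) 0
  have h2 := integrableOn_exp_mul_Ioi (neg_lt_zero.2 ha) 0
  have e : ∀ t : ℝ, Real.exp (-(t * a)) = Real.exp (-a * t) := fun t => by ring_nf
  simp only [e]
  rw [← ofReal_integral_eq_lintegral_ofReal h2 (Filter.Eventually.of_forall fun t => (Real.exp_pos _).le), h1]
  congr 1
  simp

lemma tsum_poissonWeight_mul_meanIndicator {m : ℕ} (hm : 0 < m) {x : ℝ} (hx : 0 < x) :
    ∑' n, ENNReal.ofReal (poissonWeight (m * x) n) * meanIndicator m n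
      = ENNReal.ofReal x * poissonIntegral m x := by
  have hmx : 0 ≤ m * x := by positivity
  calc ∑' n, ENNReal.ofReal (poissonWeight (m * x) n) * meanIndicator m n
      = ∑' s : Sketch m, ∑' n, ENNReal.ofReal (indicator s) *
          ENNReal.ofReal (poissonWeight (m * x) n * sketchLaw n s) := by
        rw [ENNReal.tsum_comm]
        congr 1 with n
        rw [meanIndicator, ← ENNReal.tsum_mul_left]
        congr 1 with s
        rw [ENNReal.ofReal_mul (poissonWeight_nonneg hmx n)]
        ring
    _ = ∑' s : Sketch m, ENNReal.ofReal (indicator s) * ENNReal.ofReal (∏ j, cellLaw x (s j)) := by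
        congr 1 with s
        have h := hasSum_poissonWeight_mul_sketchLaw hm x s
        rw [ENNReal.tsum_mul_left, ← h.tsum_eq, ENNReal.ofReal_tsum_of_nonneg
          (fun n => mul_nonneg (poissonWeight_nonneg hmx n) (sketchLaw_nonneg hm n s)) h.summable]
    _ = ∑' s : Sketch m, ∫⁻ t in Set.Ioi (0:ℝ),
          ∏ j, ENNReal.ofReal (cellLaw x (s j) * Real.exp (-(t * cellValue (s j)))) := by
        congr 1 with s
        rw [indicator_eq, ofReal_inv_eq_lintegral (sum_cellValue_pos hm s), mul_comm,
          ← lintegral_const_mul _ (by fun_prop)]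
        congr 1 with t
        rw [← ENNReal.ofReal_prod_of_nonneg (fun j _ => mul_nonneg (cellLaw_nonneg hx.le _) (Real.exp_pos _).le),
          ← ENNReal.ofReal_mul (Finset.prod_nonneg fun j _ => cellLaw_nonneg hx.le _), Finset.prod_mul_distrib,
          ← Real.exp_sum, Finset.sum_neg_distrib, ← Finset.mul_sum]
    _ = ∫⁻ t in Set.Ioi (0:ℝ), cellTransform x t ^ m := by
        rw [← lintegral_tsum fun s => by fun_prop]
        congr 1 with t
        exact tsum_pi_prod (fun c => ENNReal.ofReal (cellLaw x c * Real.exp (-(t * cellValue c)))) m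
    -- Substitution t = xu.
    _ = ENNReal.ofReal x * poissonIntegral m x := by
        have him : (fun u => x * u) '' Set.Ioi (0:ℝ) = Set.Ioi 0 := by
          rw [Set.image_mul_left_Ioi hx, mul_zero]
        have h := lintegral_image_eq_lintegral_abs_deriv_mul (s := Set.Ioi (0:ℝ)) (f := fun u => x * u)
          (f' := fun _ => x) measurableSet_Ioi
          (fun u _ => by simpa using ((hasDerivAt_id u).const_mul x).hasDerivWithinAt)
          (fun a _ b _ hab => mul_left_cancel₀ hx.ne' hab) (fun t => cellTransform x t ^ m)
        rw [him, abs_of_pos hx] at h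
        rw [h, poissonIntegral, lintegral_const_mul']
        exact ENNReal.ofReal_ne_top

/-! ### Probability that a new element changes the sketch -/

lemma run_congr {m : ℕ} {V : Type*} {h h' : V → Fin m × ℕ} {M : List V}
    (H : ∀ v ∈ M, h v = h' v) : run h M = run h' M := by
  rw [run_eq_iff]
  intro j
  have e : (fun r => ∃ v ∈ M, h v = (j, r)) = fun r => ∃ v ∈ M, h' v = (j, r) := by
    ext r
    exact ⟨fun ⟨v, hv, e⟩ => ⟨v, hv, (H v hv).symm.trans e⟩,
      fun ⟨v, hv, e⟩ => ⟨v, hv, (H v hv).trans e⟩⟩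
  rw [e]
  exact cellInv_run h' M j

/-- A cell changes exactly for values above the counter and, if the bit is clear, for the value just
below it. The hypothesis, true of reachable cells, keeps that lower value at least 1. -/
lemma cellUpdate_ne_iff {c : ℕ × Bool} (hc : c.2 = false → 2 ≤ c.1) (r : ℕ) :
    cellUpdate c r ≠ c ↔ r ∈ avoidSet c (false, !c.2) := by
  obtain ⟨k, b⟩ := c
  simp only at hc
  have hA : r ∈ avoidSet (k, b) (false, !b) ↔ k < r ∨ (b = false ∧ r + 1 = k) := by
    simp only [avoidSet, Set.mem_ofPred_eq, Bool.false_eq_true, false_and, false_or, Bool.not_eq_true']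
    exact or_congr_right ⟨fun h => ⟨h.1, h.2.1⟩, fun h => ⟨h.1, h.2, hc h.1⟩⟩
  rw [hA]
  unfold cellUpdate
  simp only
  split_ifs with h1 h2 h3
  · simp only [ne_eq, Prod.mk.injEq, not_and]
    exact ⟨fun _ => Or.inl (by omega), fun _ h => by omega⟩
  · simp only [ne_eq, Prod.mk.injEq, not_and]
    exact ⟨fun _ => Or.inl (by omega), fun _ h => by omega⟩
  · simp only [ne_eq, Prod.mk.injEq, true_and]
    exact ⟨fun _ => Or.inr ⟨h3.2, h3.1⟩, fun _ => by simp [h3.2]⟩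
  · simp only [ne_eq, not_true_eq_false, false_iff, not_or]
    exact ⟨by omega, fun h => h3 ⟨h.2, h.1⟩⟩

lemma avoidMass_false {c : ℕ × Bool} (hc : c.2 = false → 2 ≤ c.1) :
    avoidMass c (false, !c.2) = cellValue c := by
  obtain ⟨k, b⟩ := c
  cases b
  · have : 2 ≤ k := hc rfl
    simp [avoidMass, cellValue, this]
  · simp [avoidMass, cellValue]

lemma insert_ne_iff {m : ℕ} {s : Sketch m} (hs : ∀ j, (s j).2 = false → 2 ≤ (s j).1) (x : Fin m × ℕ) :
    insert s x ≠ s ↔ x ∈ avoidHash s fun j => (false, !(s j).2) := by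
  rw [avoidHash, Set.mem_ofPred_eq, ← cellUpdate_ne_iff (hs x.1), insert, ne_eq,
    Function.update_eq_self_iff]

lemma two_le_of_run_eq {m : ℕ} {V : Type*} {h : V → Fin m × ℕ} {M : List V} {s : Sketch m}
    (H : run h M = s) (j : Fin m) (hj : (s j).2 = false) : 2 ≤ (s j).1 := by
  obtain ⟨-, -, h3⟩ := (run_eq_iff h M s).1 H j
  by_contra hlt
  rw [h3.2 (Or.inl (by omega))] at hj
  exact absurd hj (by simp)

open ProbabilityTheory in
lemma IsRandomHash.indepFun_run {m : ℕ} {V Ω : Type*} [DecidableEq V] [MeasurableSpace Ω]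
    {P : Measure Ω} {h : V → Ω → Fin m × ℕ} (hh : IsRandomHash P h)
    {M : List V} {v : V} (hv : v ∉ M) : IndepFun (fun ω => run (h · ω) M) (h v) P := by
  rcases Nat.eq_zero_or_pos m with rfl | hm
  · have : ∀ ω : Ω, False := fun ω => (h v ω).1.elim0
    have : IsEmpty Ω := ⟨this⟩
    rw [IndepFun_iff]
    intro a b _ _
    simp [Set.eq_empty_of_isEmpty]
  have hd : Disjoint M.toFinset {v} := by simpa using hv
  have hI := hh.indep.indepFun_finset M.toFinset {v} hd hh.measurable
  let φ : (M.toFinset → Fin m × ℕ) → Sketch m := fun t =>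
    -- The default hash value is never used, since only elements of M are looked up.
    run (fun w => if hw : w ∈ M.toFinset then t ⟨w, hw⟩ else (⟨0, hm⟩, 0)) M
  let ψ : ((({v} : Finset V)) → Fin m × ℕ) → Fin m × ℕ := fun t => t ⟨v, Finset.mem_singleton_self v⟩
  have := hI.comp (φ := φ) (ψ := ψ) Measurable.of_discrete Measurable.of_discrete
  have e : (fun ω => run (h · ω) M) = φ ∘ fun ω (i : M.toFinset) => h i ω := by
    ext1 ω
    refine run_congr fun w hw => ?_
    simp [hw]
  rw [e]
  exact this

lemma IsRandomHash.cond_run_ne {m : ℕ} {V Ω : Type*} [DecidableEq V] [MeasurableSpace Ω]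
    {P : Measure Ω} [IsProbabilityMeasure P] {h : V → Ω → Fin m × ℕ} (hh : IsRandomHash P h)
    {M : List V} {v : V} (hv : v ∉ M) {s : Sketch m} (hs : P {ω | run (h · ω) M = s} ≠ 0) :
    (ProbabilityTheory.cond P {ω | run (h · ω) M = s}).real
      {ω | run (h · ω) (M ++ [v]) ≠ s} = 1 / (m * indicator s) := by
  obtain ⟨ω₀, hω₀⟩ := nonempty_of_measure_ne_zero hs
  have hval := two_le_of_run_eq (show run (h · ω₀) M = s from hω₀)
  have hA : MeasurableSet {ω | run (h · ω) M = s} :=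
    measurable_run hh.measurable M (measurableSet_singleton s)
  have e : {ω | run (h · ω) M = s} ∩ {ω | run (h · ω) (M ++ [v]) ≠ s}
      = (fun ω => run (h · ω) M) ⁻¹' {s} ∩ h v ⁻¹' (avoidHash s fun j => (false, !(s j).2)) := by
    ext ω
    simp only [Set.mem_inter_iff, Set.mem_ofPred_eq, Set.mem_preimage, Set.mem_singleton_iff,
      run_append_singleton]
    refine and_congr_right fun hr => ?_
    rw [hr, insert_ne_iff hval]
  have hI := (hh.indepFun_run hv).measure_inter_preimage_eq_mul {s}
    (avoidHash s fun j => (false, !(s j).2)) (measurableSet_singleton s)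
    (Set.to_countable _).measurableSet
  have hP : P ((fun ω => run (h · ω) M) ⁻¹' {s}) ≠ 0 := hs
  rw [measureReal_def, ProbabilityTheory.cond_apply hA, e, hI, ← mul_assoc]
  change ((P ((fun ω => run (h · ω) M) ⁻¹' {s}))⁻¹ * _ * _).toReal = _
  rw [ENNReal.inv_mul_cancel hP (measure_ne_top _ _), one_mul]
  have := hh.measureReal_avoidHash v s fun j => (false, !(s j).2)
  rw [measureReal_def] at this
  refine this.trans ?_
  simp only [avoidMass_false (hval _), indicator_eq]
  rw [one_div_mul_eq_div, one_div, mul_inv, inv_inv, div_eq_inv_mul]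

/-! ### Finiteness and asymptotics of the mean -/

/-- A Poisson average with strictly positive weights is finite, so every averaged term is finite. -/
lemma meanIndicator_ne_top {m : ℕ} (hm : 2 ≤ m) (n : ℕ) : meanIndicator m n ≠ ⊤ := by
  have hm0 : 0 < m := by omega
  have h := tsum_poissonWeight_mul_meanIndicator hm0 one_pos
  have h1 : ∑' n, ENNReal.ofReal (poissonWeight (m * 1) n) * meanIndicator m n ≠ ⊤ := by
    rw [h]
    exact ENNReal.mul_ne_top ENNReal.ofReal_ne_top (poissonIntegral_bound hm le_rfl).1
  have h2 := ENNReal.ne_top_of_tsum_ne_top h1 n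
  intro htop
  rw [htop] at h2
  refine h2 (ENNReal.mul_top ?_)
  rw [ne_eq, ENNReal.ofReal_eq_zero, not_le, poissonWeight]
  positivity

lemma hasSum_poissonWeight_mul_meanIndicator {m : ℕ} (hm : 2 ≤ m) {x : ℝ} (hx : 1 ≤ x) :
    HasSum (fun n => poissonWeight (m * x) n * (meanIndicator m n).toReal)
      (x * (poissonIntegral m x).toReal) := by
  have hx0 : 0 < x := by linarith
  have h := tsum_poissonWeight_mul_meanIndicator (by omega : 0 < m) hx0
  have hw := poissonWeight_nonneg (l := m * x) (by positivity)
  have hne : ∑' n, ENNReal.ofReal (poissonWeight (m * x) n) * meanIndicator m n ≠ ⊤ := by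
    rw [h]
    exact ENNReal.mul_ne_top ENNReal.ofReal_ne_top (poissonIntegral_bound hm hx).1
  have h2 := ENNReal.hasSum_toReal hne
  rw [← ENNReal.tsum_toReal_eq (ENNReal.ne_top_of_tsum_ne_top hne), h] at h2
  simpa [ENNReal.toReal_mul, ENNReal.toReal_ofReal, hw, hx0.le] using h2

open Filter in
lemma eventually_abs_meanIndicator_sub_le {m : ℕ} (hm : 2 ≤ m) {δ : ℝ} (hδ : 0 < δ) :
    ∀ᶠ n : ℕ in atTop, |m * (meanIndicator m n).toReal / n - ∫ u in Set.Ioi (0:ℝ), f u ^ m|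
      ≤ 0.000084 / m + δ := by
  have hm0 : (0:ℝ) < m := by positivity
  have hmono : Monotone fun n => m * (meanIndicator m n).toReal := fun a b hab => by
    have := ENNReal.toReal_mono (meanIndicator_ne_top hm b) (monotone_meanIndicator (by omega) hab)
    simp only
    gcongr
  refine eventually_abs_div_sub_le hmono (fun n => by positivity)
    (p := fun l => l * (poissonIntegral m (l / m)).toReal)
    (setIntegral_nonneg measurableSet_Ioi fun u hu => pow_nonneg (f_nonneg (le_of_lt hu)) m)
    (by positivity) ?_ ?_ hδ
  · filter_upwards [eventually_ge_atTop (m : ℝ)] with l hl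
    have h := (hasSum_poissonWeight_mul_meanIndicator hm (x := l / m) (by rwa [le_div_iff₀ hm0, one_mul])).mul_left (m : ℝ)
    rw [mul_div_cancel₀ _ hm0.ne', ← mul_assoc, mul_div_cancel₀ _ hm0.ne'] at h
    refine h.congr_fun fun n => ?_
    ring
  · intro δ hδ
    have ht : Tendsto (fun l : ℝ => 8 * m * 10 ^ m / (l / m)) atTop (nhds 0) :=
      tendsto_const_nhds.div_atTop (tendsto_id.atTop_div_const hm0)
    filter_upwards [eventually_ge_atTop (m : ℝ), ht.eventually_lt_const hδ] with l hl hl2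
    have hl0 : 0 < l := lt_of_lt_of_le hm0 hl
    have h := (poissonIntegral_bound hm (x := l / m) (by rwa [le_div_iff₀ hm0, one_mul])).2
    rw [mul_div_cancel_left₀ _ hl0.ne']
    linarith

end EHLL

theorem theorem4p1 (m : ℕ) (hm : 2 ≤ m) :
    IntegrableOn (fun u : ℝ => EHLL.f u ^ m) (Set.Ioi 0) ∧
    ∃ ε δ : ℕ → ℝ,
      (∀ n, |ε n| ≤ 8.4 * (10 : ℝ) ^ (-5 : ℤ)) ∧
      Filter.Tendsto δ Filter.atTop (nhds 0) ∧
      ∀ (V : Type*) [DecidableEq V] (Ω : Type*) [MeasurableSpace Ω] (P : Measure Ω)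
        [IsProbabilityMeasure P] (h : V → Ω → Fin m × ℕ), EHLL.IsRandomHash P h →
        ∀ M : List V,
          -- `1 / (m Y)` is the probability that a new element changes the current sketch `s`
          (∀ v, v ∉ M → ∀ s : EHLL.Sketch m, P {ω | EHLL.run (h · ω) M = s} ≠ 0 →
            (ProbabilityTheory.cond P {ω | EHLL.run (h · ω) M = s}).real
              {ω | EHLL.run (h · ω) (M ++ [v]) ≠ s} = 1 / (m * EHLL.indicator s)) ∧
          Integrable (fun ω => EHLL.indicator (EHLL.run (h · ω) M)) P ∧
          -- the number `n` of distinct elements of the stream is `M.toFinset.card`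
          ∀ n : ℕ, M.toFinset.card = n → 1 ≤ n →
            ∫ ω, EHLL.indicator (EHLL.run (h · ω) M) ∂P =
              (n : ℝ) / m * ((∫ u in Set.Ioi (0 : ℝ), EHLL.f u ^ m) + ε n / m + δ n) := by
  have hm0 : (0:ℝ) < m := by positivity
  refine ⟨EHLL.integrableOn_f_pow hm, ?_⟩
  set E : ℝ := 8.4 * (10 : ℝ) ^ (-5 : ℤ) with hE
  have hE0 : 0 ≤ E := by positivity
  have hEe : (0.000084 : ℝ) = E := by rw [hE]; norm_num
  set r : ℕ → ℝ := fun n =>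
    m * (EHLL.meanIndicator m n).toReal / n - ∫ u in Set.Ioi (0:ℝ), EHLL.f u ^ m with hr
  have hlim : ∀ δ > 0, ∀ᶠ n in Filter.atTop, |r n| ≤ E / m + δ := fun δ hδ => by
    rw [← hEe]; exact EHLL.eventually_abs_meanIndicator_sub_le hm hδ
  clear_value E r
  -- Here ε is the normalized error m·r clamped to [-E, E], so its bound holds for every n. The rest
  -- is δ, which tends to 0 because |m·r| eventually exceeds E by arbitrarily little.
  refine ⟨fun n => max (-E) (min E (m * r n)), fun n => r n - max (-E) (min E (m * r n)) / m,
    fun n => ?_, ?_, ?_⟩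
  · rw [abs_le]
    exact ⟨le_max_left _ _, max_le (by linarith) (min_le_left _ _)⟩
  · rw [Metric.tendsto_atTop']
    intro δ hδ
    obtain ⟨N, hN⟩ := Filter.eventually_atTop.1 (hlim (δ / 2) (by positivity))
    refine ⟨N, fun n hn => ?_⟩
    have h := hN n hn.le
    rw [dist_zero_right, Real.norm_eq_abs]
    have hc : |m * r n - max (-E) (min E (m * r n))| ≤ m * (δ / 2) := by
      have h1 : |m * r n| ≤ E + m * (δ / 2) := by
        rw [abs_mul, abs_of_pos hm0]
        calc m * |r n| ≤ m * (E / m + δ / 2) := by gcongr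
          _ = E + m * (δ / 2) := by field_simp
      have h2 : 0 ≤ m * (δ / 2) := by positivity
      rw [abs_le] at h1 ⊢
      rcases le_total E (m * r n) with a | a
      · rw [min_eq_left a, max_eq_right (by linarith)]
        constructor <;> linarith
      · rw [min_eq_right a]
        rcases le_total (-E) (m * r n) with b | b
        · rw [max_eq_right b]; constructor <;> linarith
        · rw [max_eq_left b]; constructor <;> linarith
    have e : r n - max (-E) (min E (m * r n)) / m = (m * r n - max (-E) (min E (m * r n))) / m := by
      field_simp
    rw [e, abs_div, abs_of_pos hm0, div_lt_iff₀ hm0]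
    nlinarith
  · intro V _ Ω _ P _ h hh M
    have hmeas : Measurable fun ω => EHLL.indicator (EHLL.run (h · ω) M) :=
      (Measurable.of_discrete (f := fun s : EHLL.Sketch m => EHLL.indicator s)).comp
        (EHLL.measurable_run hh.measurable M)
    have hl := hh.lintegral_indicator_run M
    refine ⟨fun v hv s hs => hh.cond_run_ne hv hs, ?_, ?_⟩
    · refine ⟨hmeas.aestronglyMeasurable, ?_⟩
      rw [hasFiniteIntegral_iff_ofReal (Filter.Eventually.of_forall fun ω => EHLL.indicator_nonneg _), hl]
      exact (EHLL.meanIndicator_ne_top hm _).lt_top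
    · intro n hn hn1
      have hn0 : (0:ℝ) < n := by exact_mod_cast hn1
      rw [integral_eq_lintegral_of_nonneg_ae
        (Filter.Eventually.of_forall fun ω => EHLL.indicator_nonneg _) hmeas.aestronglyMeasurable, hl, hn]
      simp only [hr]
      field_simp
      ring
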